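/- Let $N\ge 2$ be an integer, let $p>1$, $\beta<0$ and $\omega>\frac{p+1}{p-1}\frac{N^2}{\beta^2}$ be real numbers, and let $\Gamma$ be the star graph consisting of $N$ half-lines $(0,\infty)$ joined at the vertex $0$. Functions on $\Gamma$ are tuples $v=(v_j)_{j=1}^N$ with $v_j:(0,\infty)\to\mathbb C$; put $H^1(\Gamma)=\bigoplus_{j=1}^N H^1(\mathbb R^+)$, $\|v\|_q^q=\sum_{j=1}^N\int_0^\infty|v_j(x)|^q\,dx$, and let $v_j(0)$ be the limit of (the continuous representative of) $v_j$ at $0+$. For $v\in H^1(\Gamma)$ define $$F_\beta(v)=\|v'\|_2^2+\frac1\beta\Big|\sum_{j=1}^N v_j(0)\Big|^2,\qquad S_\omega(v)=\tfrac12F_\beta(v)+\tfrac\omega2\|v\|_2^2-\tfrac1{p+1}\|v\|_{p+1}^{p+1},$$ $$I_\omega(v)=F_\beta(v)+\omega\|v\|_2^2-\|v\|_{p+1}^{p+1},$$ and consider the minimization problem $$d_\omega=\inf\{S_\omega(v):\ v\in H^1(\Gamma)\setminus\{0\},\ I_\omega(v)=0\}.\tag{d}$$ For $a\in\mathbb R$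 let $$\phi_a(x)=\Big\{\tfrac{(p+1)\omega}{2}\,\mathrm{sech}^2\Big(\tfrac{(p-1)\sqrt\omega}{2}(x+a)\Big)\Big\}^{\frac1{p-1}}.$$ Then there is exactly one pair $(t_1,t_N)$ with $0<t_1<t_N<1$ and $$t_1^{p-1}-t_1^{p+1}=t_N^{p-1}-t_N^{p+1},\qquad t_1^{-1}+(N-1)\,t_N^{-1}=|\beta|\sqrt\omega .$$ With $x_1=\frac{2}{(p-1)\sqrt\omega}\tanh^{-1}(t_1)$ and $x_N=\frac{2}{(p-1)\sqrt\omega}\tanh^{-1}(t_N)$, let $\phi_1=(\phi_{x_1},\phi_{x_N},\dots,\phi_{x_N})$ be the asymmetric tail profile on $\Gamma$ (one entry $\phi_{x_1}$ and $N-1$ entries $\phi_{x_N}$). If problem (d) has a solution, that is, if the infimum $d_\omega$ is attained, then it is given by $\phi_1$, up to rotation and permutation of the edges: a function $v$ is a solution of (d) if and only if there are $\theta\in\mathbb R$ and a permutation $\sigma$ of $\{1,\dots,N\}$ such that $v_j=e^{i\theta}(\phi_1)_{\sigma(j)}$ on $[0,\infty)$ for all $j=1,\dots,N$. -/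

import Mathlib

open MeasureTheory Set Filter Topology

noncomputable section

namespace StarGraph

/-- `g` is a weak derivative of `v` on the half-line `(0, ∞)`: integration by parts holds against
every smooth test function with compact support contained in `(0, ∞)`. -/
def IsWeakDeriv (v g : ℝ → ℂ) : Prop :=
  ∀ η : ℝ → ℝ, ContDiff ℝ (⊤ : ℕ∞) η → HasCompactSupport η → tsupport η ⊆ Ioi 0 →
    ∫ x in Ioi (0 : ℝ), ((deriv η x : ℝ) : ℂ) * v x = - ∫ x in Ioi (0 : ℝ), ((η x : ℝ) : ℂ) * g x

/-- `g` is a weak derivative of `v` on `(0, ∞)` lying in `L²(0, ∞)`. -/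
def IsL2WeakDeriv (v g : ℝ → ℂ) : Prop :=
  MemLp g 2 (volume.restrict (Ioi 0)) ∧ IsWeakDeriv v g

/-- `v` is (the continuous representative on `[0, ∞)` of) an element of `H¹(ℝ⁺)`. In particular
`v 0` is the limit of `v x` as `x → 0+`. Values of `v` at negative numbers play no role. -/
structure MemH1HalfLine (v : ℝ → ℂ) : Prop where
  continuousOn : ContinuousOn v (Ici 0)
  memLp : MemLp v 2 (volume.restrict (Ioi 0))
  exists_weakDeriv : ∃ g : ℝ → ℂ, IsL2WeakDeriv v g

open Classical in
/-- The weak derivative in `L²(0, ∞)` (well defined up to null sets), and `0` if there is none. -/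
def weakDeriv (v : ℝ → ℂ) : ℝ → ℂ :=
  if h : ∃ g : ℝ → ℂ, IsL2WeakDeriv v g then h.choose else 0

/-- `v = (v_j)_j` is an element of `H¹(Γ) = ⨁_j H¹(ℝ⁺)`, where `Γ` is the star graph with `N`
half-lines. -/
def MemH1 {N : ℕ} (v : Fin N → ℝ → ℂ) : Prop :=
  ∀ j, MemH1HalfLine (v j)

/-- `‖v‖_q^q` in `L^q(Γ)`. -/
def lpNormPow {N : ℕ} (q : ℝ) (v : Fin N → ℝ → ℂ) : ℝ :=
  ∑ j, ∫ x in Ioi (0 : ℝ), ‖v j x‖ ^ q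

/-- The quadratic form `F_β(v) = ‖v'‖₂² + (1/β) |∑_j v_j(0)|²` of the `δ'_s` coupling. -/
def quadForm {N : ℕ} (β : ℝ) (v : Fin N → ℝ → ℂ) : ℝ :=
  lpNormPow 2 (fun j => weakDeriv (v j)) + 1 / β * ‖∑ j, v j 0‖ ^ 2

/-- The action functional `S_ω`. -/
def action {N : ℕ} (p β ω : ℝ) (v : Fin N → ℝ → ℂ) : ℝ :=
  1 / 2 * quadForm β v + ω / 2 * lpNormPow 2 v - 1 / (p + 1) * lpNormPow (p + 1) v

/-- The Nehari functional `I_ω`. -/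
def nehari {N : ℕ} (p β ω : ℝ) (v : Fin N → ℝ → ℂ) : ℝ :=
  quadForm β v + ω * lpNormPow 2 v - lpNormPow (p + 1) v

/-- The constraint set `{v ∈ H¹(Γ) \ {0} : I_ω(v) = 0}`. -/
def nehariSet (N : ℕ) (p β ω : ℝ) : Set (Fin N → ℝ → ℂ) :=
  {v | MemH1 v ∧ (∃ j, ∃ x : ℝ, 0 ≤ x ∧ v j x ≠ 0) ∧ nehari p β ω v = 0}

/-- `v` solves the minimization problem
`d_ω = inf {S_ω(u) : u ∈ H¹(Γ) \ {0}, I_ω(u) = 0}`, i.e. `v` is admissible and attains `d_ω`. -/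
def IsNehariMinimizer {N : ℕ} (p β ω : ℝ) (v : Fin N → ℝ → ℂ) : Prop :=
  v ∈ nehariSet N p β ω ∧ IsMinOn (action p β ω) (nehariSet N p β ω) v

/-- The shifted soliton
`φ_a(x) = ((p+1)ω/2 · sech²((p-1)√ω/2 · (x + a)))^{1/(p-1)}`. -/
def soliton (p ω a x : ℝ) : ℝ :=
  ((p + 1) * ω / 2 * (1 / Real.cosh ((p - 1) * Real.sqrt ω / 2 * (x + a))) ^ 2) ^ (1 / (p - 1))

/-- The system for the parameters `0 < t₁ < t_N < 1` of the asymmetric profile `φ_k`. -/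
structure IsProfileParam (N k : ℕ) (p β ω t₁ tN : ℝ) : Prop where
  pos : 0 < t₁
  lt : t₁ < tN
  lt_one : tN < 1
  eq_slope : t₁ ^ (p - 1) - t₁ ^ (p + 1) = tN ^ (p - 1) - tN ^ (p + 1)
  eq_sum : (k : ℝ) * t₁⁻¹ + ((N : ℝ) - k) * tN⁻¹ = |β| * Real.sqrt ω

/-- The shift `2 / ((p-1)√ω) · tanh⁻¹ t` attached to the parameter `t ∈ (0, 1)`. It is positive,
which is the sign that belongs to `β < 0`. -/
def shift (p ω t : ℝ) : ℝ :=
  2 / ((p - 1) * Real.sqrt ω) * Real.artanh t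

/-- For `β < 0`, the asymmetric profile `φ_k` with parameters `(t₁, t_N)`: the first `k` entries
are `φ_{x₁}`, the last `N - k` entries are `φ_{x_N}`. -/
def profile (N k : ℕ) (p ω t₁ tN : ℝ) (j : Fin N) (x : ℝ) : ℝ :=
  if j.val < k then soliton p ω (shift p ω t₁) x else soliton p ω (shift p ω tN) x

end StarGraph

end

/-!
A minimizer `v` of the action on the Nehari manifold also minimizes, by homogeneity, the quotient of
`(F_β + ω ‖·‖₂²) ^ (p + 1)` by the square of `‖·‖_{p+1}^{p+1}`, among the functions with positive
quadratic part (`IsNehariMinimizer.le_linForm`). All variations below use this inequality, which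
needs no constraint. Only variations close to `v` occur, for which positivity is automatic.

* First variation: `v_j'' = ω v_j - |v_j|^(p-1) v_j` on every edge, and `v_j'(0) = (1/β) ∑ v_i(0)`
  (`IsNehariMinimizer.exists_isEdgeSolution`). Instead of differentiating the `L^(p+1)` norm, one
  bounds it from below by its tangent, since it is convex.
* On an edge, energy and angular momentum are constant and integrable, hence zero. So a solution is
  zero, or it has constant phase and its modulus `U` solves a first order equation, and then
  `w = U^(-(p-1)/2)` solves the linear equation `w'' = k² w`. Thus `v_j` is a shifted soliton up to
  phase (`IsEdgeSolution.exists_eq_soliton`).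
* Rotating the phase on one edge changes only the coupling term. As `β < 0`, minimality aligns all
  phases (`IsNehariMinimizer.inner_sub_nonneg`), so that `v_j = e^{iθ} φ_{a_j}` with `a_j > 0`. With
  `t_j = tanh ((p-1) √ω a_j / 2)` the vertex conditions say that `t_j^(p-1) - t_j^(p+1)` does not
  depend on `j`, and that `∑ t_j⁻¹ = |β| √ω`.
* The function `t^(p-1) - t^(p+1)` increases up to `τ = √((p-1)/(p+1))` and decreases afterwards. If
  two of the `t_j` were below `τ`, they would be equal, and shifting one of the two solitons to the
  left and the other one to the right would give a negative second variation
  (`IsNehariMinimizer.soliton_deriv_deriv_nonneg`). If none were below `τ`, then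
  `∑ t_j⁻¹ ≤ N / τ < |β| √ω`. So exactly one is below `τ` and the others coincide.
* The pair `(t₁, tN)` is unique: in terms of `u = log (tN / t₁)`, the square of
  `t₁⁻¹ + (N - 1) tN⁻¹` is a log-convex function of `u > 0`. It tends to `N² (p+1)/(p-1)` at `0` and
  to infinity at infinity, so that it takes every larger value exactly once
  (`existsUnique_isProfileParam`).

Conversely, the problem is invariant under a global phase and under permutations of the edges.
Hence, as soon as one minimizer exists, all functions of the asserted form are minimizers.
-/

open MeasureTheory Set Filter Topology

noncomputable section

namespace StarGraph

variable {N : ℕ}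

/-! ### Weak derivatives and the lemma of du Bois-Reymond -/

/-- A test function on `(0, ∞)` of mean zero is the derivative of a test function. -/
theorem exists_test_primitive {κ : ℝ → ℝ} (hκ : ContDiff ℝ (⊤ : ℕ∞) κ) (hc : HasCompactSupport κ)
    (hs : tsupport κ ⊆ Ioi 0) (h0 : ∫ x, κ x = 0) :
    ∃ η : ℝ → ℝ, ContDiff ℝ (⊤ : ℕ∞) η ∧ HasCompactSupport η ∧ tsupport η ⊆ Ioi 0 ∧
      deriv η = κ := by
  obtain ⟨a, b, ha, hab⟩ : ∃ a b : ℝ, 0 < a ∧ tsupport κ ⊆ Icc a b := by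
    obtain ⟨b, hb⟩ := hc.isCompact.bddAbove
    rcases (tsupport κ).eq_empty_or_nonempty with h | h
    · exact ⟨1, b, one_pos, by simp [h]⟩
    · obtain ⟨a, ha⟩ := hc.isCompact.exists_isLeast h
      exact ⟨a, b, hs ha.1, fun x hx => ⟨ha.2 hx, hb hx⟩⟩
  have hκ0 : ∀ x, x ∉ Icc a b → κ x = 0 := fun x hx => by
    by_contra h
    exact hx (hab (subset_tsupport _ h))
  have hint : Integrable κ := hκ.continuous.integrable_of_hasCompactSupport hc
  have hd : ∀ x, HasDerivAt (fun x => ∫ t in (0 : ℝ)..x, κ t) (κ x) x := fun x =>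
    intervalIntegral.integral_hasDerivAt_right (hκ.continuous.intervalIntegrable _ _)
      (hκ.continuous.stronglyMeasurableAtFilter _ _) hκ.continuous.continuousAt
  have hder : deriv (fun x => ∫ t in (0 : ℝ)..x, κ t) = κ := funext fun x => (hd x).deriv
  have hzero : ∀ x, x ∉ Icc a b → ∫ t in (0 : ℝ)..x, κ t = 0 := by
    intro x hx
    rcases lt_or_ge x a with hxa | hxa
    · refine intervalIntegral.integral_zero_ae (Eventually.of_forall fun t ht => ?_)
      refine hκ0 t fun h => ?_
      have := (mem_uIoc.1 ht)
      rcases this with h1 | h1 <;> linarith [h.1, h1.1, h1.2]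
    · have hxb : b < x := by
        by_contra h
        exact hx ⟨hxa, not_lt.1 h⟩
      rw [intervalIntegral.integral_of_le (ha.le.trans hxa)]
      refine Eq.trans ?_ h0
      refine setIntegral_eq_integral_of_forall_compl_eq_zero fun t ht => hκ0 t fun h => ht ?_
      exact ⟨ha.trans_le h.1, h.2.trans hxb.le⟩
  have hsupp : tsupport (fun x => ∫ t in (0 : ℝ)..x, κ t) ⊆ Icc a b := by
    refine closure_minimal (fun x hx => ?_) isClosed_Icc
    by_contra h
    exact hx (hzero x h)
  refine ⟨fun x => ∫ t in (0 : ℝ)..x, κ t, ?_, ?_, ?_, hder⟩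
  · rw [contDiff_infty_iff_deriv, hder]
    exact ⟨fun x => (hd x).differentiableAt, hκ⟩
  · exact isCompact_Icc.of_isClosed_subset (isClosed_tsupport _) hsupp
  · exact hsupp.trans fun x hx => ha.trans_le hx.1

/-- A locally integrable function which is integrated to zero against every test function
supported in `(0, ∞)` vanishes almost everywhere there. -/
theorem ae_eq_zero_of_test {f : ℝ → ℂ} (hf : LocallyIntegrableOn f (Ioi 0))
    (h : ∀ η : ℝ → ℝ, ContDiff ℝ (⊤ : ℕ∞) η → HasCompactSupport η → tsupport η ⊆ Ioi 0 →
      ∫ x in Ioi (0 : ℝ), ((η x : ℝ) : ℂ) * f x = 0) :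
    ∀ᵐ x ∂(volume.restrict (Ioi (0 : ℝ))), f x = 0 := by
  rw [ae_restrict_iff' measurableSet_Ioi]
  refine isOpen_Ioi.ae_eq_zero_of_integral_contDiff_smul_eq_zero hf fun η h1 h2 h3 => ?_
  rw [← h η h1 h2 h3]
  rw [setIntegral_eq_integral_of_forall_compl_eq_zero]
  · simp
  · intro x hx
    rw [image_eq_zero_of_notMem_tsupport fun h' => hx (h3 h')]
    simp

theorem integrableOn_test_mul {f : ℝ → ℂ} (hf : LocallyIntegrableOn f (Ioi 0)) {η : ℝ → ℝ}
    (h1 : Continuous η) (h2 : HasCompactSupport η) (h3 : tsupport η ⊆ Ioi 0) :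
    IntegrableOn (fun x => ((η x : ℝ) : ℂ) * f x) (Ioi 0) := by
  have h := hf.integrableOn_compact_subset h3 h2.isCompact
  have h4 : IntegrableOn (fun x => ((η x : ℝ) : ℂ) * f x) (tsupport η) :=
    h.continuousOn_mul (Complex.continuous_ofReal.comp h1).continuousOn h2.isCompact
  have h5 : Integrable (fun x => ((η x : ℝ) : ℂ) * f x) := by
    refine (integrableOn_iff_integrable_of_support_subset ?_).1 h4
    intro x hx
    refine subset_tsupport _ fun h => hx ?_
    simp [h]
  exact h5.integrableOn

/-- The lemma of du Bois-Reymond: a function on `(0, ∞)` with vanishing weak derivative is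
constant. -/
theorem ae_eq_const_of_weakDeriv_zero {f : ℝ → ℂ} (hf : LocallyIntegrableOn f (Ioi 0))
    (h : ∀ η : ℝ → ℝ, ContDiff ℝ (⊤ : ℕ∞) η → HasCompactSupport η → tsupport η ⊆ Ioi 0 →
      ∫ x in Ioi (0 : ℝ), ((deriv η x : ℝ) : ℂ) * f x = 0) :
    ∃ c : ℂ, ∀ᵐ x ∂(volume.restrict (Ioi (0 : ℝ))), f x = c := by
  obtain ⟨ρ, hρ1, hρ2, hρ3, hρ4⟩ : ∃ ρ : ℝ → ℝ, ContDiff ℝ (⊤ : ℕ∞) ρ ∧ HasCompactSupport ρ ∧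
      tsupport ρ ⊆ Ioi 0 ∧ ∫ x, ρ x = 1 := by
    let b : ContDiffBump (2 : ℝ) := ⟨1 / 2, 1, by norm_num, by norm_num⟩
    refine ⟨b.normed volume, b.contDiff_normed, b.hasCompactSupport_normed, ?_, b.integral_normed⟩
    rw [b.tsupport_normed_eq, Real.closedBall_eq_Icc]
    intro x hx
    have := hx.1
    norm_num [b] at this
    exact lt_of_lt_of_le one_pos this
  refine ⟨∫ x in Ioi (0 : ℝ), ((ρ x : ℝ) : ℂ) * f x, ?_⟩
  set c := ∫ x in Ioi (0 : ℝ), ((ρ x : ℝ) : ℂ) * f x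
  have hfc : LocallyIntegrableOn (fun x => f x - c) (Ioi 0) :=
    hf.sub ((locallyIntegrable_const c).locallyIntegrableOn _)
  have key := ae_eq_zero_of_test hfc ?_
  · filter_upwards [key] with x hx using sub_eq_zero.1 hx
  intro ζ h1 h2 h3
  -- `ζ - m ρ` has mean zero, so it is the derivative of a test function
  set m := ∫ x, ζ x
  have hζi : Integrable ζ := h1.continuous.integrable_of_hasCompactSupport h2
  have hρi : Integrable ρ := hρ1.continuous.integrable_of_hasCompactSupport hρ2
  have hsub : tsupport (fun x => ζ x - m * ρ x) ⊆ tsupport ζ ∪ tsupport ρ := by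
    refine closure_minimal (fun x hx => ?_) ((isClosed_tsupport _).union (isClosed_tsupport _))
    by_contra hcon
    rw [mem_union, not_or] at hcon
    apply hx
    simp [image_eq_zero_of_notMem_tsupport hcon.1, image_eq_zero_of_notMem_tsupport hcon.2]
  obtain ⟨η, e1, e2, e3, e4⟩ := exists_test_primitive (κ := fun x => ζ x - m * ρ x)
    (h1.sub (contDiff_const.mul hρ1))
    ((h2.isCompact.union hρ2.isCompact).of_isClosed_subset (isClosed_tsupport _) hsub)
    (hsub.trans (union_subset h3 hρ3))
    (by rw [integral_sub hζi (hρi.const_mul m), integral_const_mul, hρ4]; simp [m])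
  have h0 := h η e1 e2 e3
  rw [e4] at h0
  have i1 := integrableOn_test_mul hf h1.continuous h2 h3
  have i2 := integrableOn_test_mul hf hρ1.continuous hρ2 hρ3
  have hm : ∫ x in Ioi (0 : ℝ), ((ζ x : ℝ) : ℂ) = (m : ℂ) := by
    rw [setIntegral_eq_integral_of_forall_compl_eq_zero, integral_complex_ofReal]
    intro x hx
    rw [image_eq_zero_of_notMem_tsupport fun h' => hx (h3 h')]
    simp
  have e : ∀ x, ((ζ x - m * ρ x : ℝ) : ℂ) * f x
      = ((ζ x : ℝ) : ℂ) * f x - (m : ℂ) * (((ρ x : ℝ) : ℂ) * f x) := by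
    intro x; push_cast; ring
  simp_rw [e] at h0
  rw [integral_sub i1 (i2.const_mul _), integral_const_mul] at h0
  have i3 : IntegrableOn (fun x => ((ζ x : ℝ) : ℂ) * c) (Ioi 0) :=
    (hζi.ofReal (𝕜 := ℂ)).integrableOn.mul_const c
  simp_rw [mul_sub]
  rw [integral_sub i1 i3, integral_mul_const, hm]
  exact h0

/-- Integration by parts against the primitive of a locally integrable function. -/
theorem integral_deriv_test_mul_primitive {g : ℝ → ℂ} (hg : ∀ R : ℝ, IntegrableOn g (Ioc 0 R))
    {η : ℝ → ℝ} (h1 : ContDiff ℝ (⊤ : ℕ∞) η) (h2 : HasCompactSupport η) :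
    ∫ x in Ioi (0 : ℝ), ((deriv η x : ℝ) : ℂ) * ∫ t in (0 : ℝ)..x, g t
      = - ∫ x in Ioi (0 : ℝ), ((η x : ℝ) : ℂ) * g x := by
  obtain ⟨R, hR⟩ : ∃ R : ℝ, 0 < R ∧ ∀ x, R < x → x ∉ tsupport η := by
    obtain ⟨b, hb⟩ := h2.isCompact.bddAbove
    exact ⟨max b 1, by positivity, fun x hx h => absurd (hb h)
      (not_le.2 ((le_max_left _ _).trans_lt hx))⟩
  obtain ⟨hR0, hR⟩ := hR
  have hη0 : ∀ x, R < x → η x = 0 := fun x hx => image_eq_zero_of_notMem_tsupport (hR x hx)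
  have hd0 : ∀ x, R < x → deriv η x = 0 := fun x hx =>
    image_eq_zero_of_notMem_tsupport fun h => hR x hx (tsupport_deriv_subset h)
  have hcd : Continuous (deriv η) := h1.continuous_deriv (by simp)
  have hdiff : ∀ x, HasDerivAt η (deriv η x) x := fun x =>
    ((h1.differentiable (by simp)) x).hasDerivAt
  have r1 : ∫ x in Ioi (0 : ℝ), ((deriv η x : ℝ) : ℂ) * ∫ t in (0 : ℝ)..x, g t
      = ∫ x in Ioc (0 : ℝ) R, ((deriv η x : ℝ) : ℂ) * ∫ t in (0 : ℝ)..x, g t := by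
    refine setIntegral_eq_of_subset_of_forall_sdiff_eq_zero measurableSet_Ioi
      (fun x hx => hx.1) fun x hx => ?_
    rw [hd0 x (by by_contra h; exact hx.2 ⟨hx.1, not_lt.1 h⟩)]; simp
  have r2 : ∫ x in Ioi (0 : ℝ), ((η x : ℝ) : ℂ) * g x
      = ∫ x in Ioc (0 : ℝ) R, ((η x : ℝ) : ℂ) * g x := by
    refine setIntegral_eq_of_subset_of_forall_sdiff_eq_zero measurableSet_Ioi
      (fun x hx => hx.1) fun x hx => ?_
    rw [hη0 x (by by_contra h; exact hx.2 ⟨hx.1, not_lt.1 h⟩)]; simp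
  rw [r1, r2]
  -- Fubini on the triangle `0 < t ≤ x ≤ R`
  set μ := volume.restrict (Ioc (0 : ℝ) R)
  have hprod : Integrable (fun z : ℝ × ℝ => ((deriv η z.1 : ℝ) : ℂ) * g z.2) (μ.prod μ) :=
    Integrable.mul_prod (f := fun x => ((deriv η x : ℝ) : ℂ))
      ((Complex.continuous_ofReal.comp hcd).integrableOn_Ioc) (hg R)
  have hS : MeasurableSet {z : ℝ × ℝ | z.2 ≤ z.1} := measurableSet_le measurable_snd measurable_fst
  have hsw := integral_integral_swap (μ := μ) (ν := μ)
    (f := fun x t => {z : ℝ × ℝ | z.2 ≤ z.1}.indicator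
      (fun z : ℝ × ℝ => ((deriv η z.1 : ℝ) : ℂ) * g z.2) (x, t)) (hprod.indicator hS)
  have l1 : ∀ x ∈ Ioc (0 : ℝ) R, ∫ t, {z : ℝ × ℝ | z.2 ≤ z.1}.indicator
      (fun z : ℝ × ℝ => ((deriv η z.1 : ℝ) : ℂ) * g z.2) (x, t) ∂μ
        = ((deriv η x : ℝ) : ℂ) * ∫ t in (0 : ℝ)..x, g t := by
    intro x hx
    rw [intervalIntegral.integral_of_le hx.1.le, ← integral_const_mul,
      show Ioc (0 : ℝ) x = Ioc 0 R ∩ Iic x by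
        ext t; simp only [mem_Ioc, mem_inter_iff, mem_Iic]
        exact ⟨fun h => ⟨⟨h.1, h.2.trans hx.2⟩, h.2⟩, fun h => ⟨h.1.1, h.2⟩⟩,
      inter_comm, ← Measure.restrict_restrict measurableSet_Iic, ← integral_indicator
        measurableSet_Iic]
    rfl
  have l2 : ∀ t ∈ Ioc (0 : ℝ) R, ∫ x, {z : ℝ × ℝ | z.2 ≤ z.1}.indicator
      (fun z : ℝ × ℝ => ((deriv η z.1 : ℝ) : ℂ) * g z.2) (x, t) ∂μ
        = - (((η t : ℝ) : ℂ) * g t) := by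
    intro t ht
    have e1 : ∀ x, {z : ℝ × ℝ | z.2 ≤ z.1}.indicator
      (fun z : ℝ × ℝ => ((deriv η z.1 : ℝ) : ℂ) * g z.2) (x, t)
        = (Ici t).indicator (fun x => ((deriv η x : ℝ) : ℂ)) x * g t := by
      intro x
      by_cases h : t ≤ x <;> simp [indicator, h]
    simp_rw [e1]
    rw [integral_mul_const, integral_indicator measurableSet_Ici,
      Measure.restrict_restrict measurableSet_Ici,
      show Ici t ∩ Ioc 0 R = Icc t R by
        ext x; simp only [mem_Ioc, mem_inter_iff, mem_Ici, mem_Icc]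
        exact ⟨fun h => ⟨h.1, h.2.2⟩, fun h => ⟨h.1, ht.1.trans_le h.1, h.2⟩⟩,
      integral_Icc_eq_integral_Ioc, integral_complex_ofReal,
      ← intervalIntegral.integral_of_le ht.2,
      intervalIntegral.integral_eq_sub_of_hasDerivAt (fun x _ => hdiff x)
        (hcd.intervalIntegrable _ _)]
    have : η R = 0 := by
      have hev : ∀ᶠ x in 𝓝[>] R, η x = 0 := by
        filter_upwards [self_mem_nhdsWithin] with x hx using hη0 x hx
      exact tendsto_nhds_unique
        (h1.continuous.continuousAt.tendsto.mono_left nhdsWithin_le_nhds)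
        ((tendsto_congr' hev).2 tendsto_const_nhds)
    rw [this]; push_cast; ring
  rw [← setIntegral_congr_fun measurableSet_Ioc l1, hsw,
    setIntegral_congr_fun measurableSet_Ioc l2, integral_neg]

theorem locallyIntegrableOn_Ioi {f : ℝ → ℂ} (hf : ∀ R : ℝ, IntegrableOn f (Ioc 0 R)) :
    LocallyIntegrableOn f (Ioi 0) := by
  intro x hx
  exact ⟨Ioc 0 (x + 1), mem_nhdsWithin_of_mem_nhds (Ioc_mem_nhds hx (by linarith)), hf _⟩

/-- A function with a locally integrable weak derivative is a primitive of it. -/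
theorem IsWeakDeriv.exists_ae_eq {v g : ℝ → ℂ} (h : IsWeakDeriv v g)
    (hv : ∀ R : ℝ, IntegrableOn v (Ioc 0 R)) (hg : ∀ R : ℝ, IntegrableOn g (Ioc 0 R)) :
    ∃ c : ℂ, ∀ᵐ x ∂(volume.restrict (Ioi (0 : ℝ))), v x = c + ∫ t in (0 : ℝ)..x, g t := by
  have hp : ∀ R : ℝ, ContinuousOn (fun x => ∫ t in (0 : ℝ)..x, g t) (Icc 0 R) := fun R =>
    intervalIntegral.continuousOn_primitive_interval' (b₁ := 0) (b₂ := max R 0)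
      ((intervalIntegrable_iff_integrableOn_Ioc_of_le (le_max_right _ _)).2 (hg _))
      (by simp) |>.mono (by
        rw [uIcc_of_le (le_max_right _ _)]; exact Icc_subset_Icc_right (le_max_left _ _))
  have hpl : LocallyIntegrableOn (fun x => ∫ t in (0 : ℝ)..x, g t) (Ioi 0) :=
    locallyIntegrableOn_Ioi fun R => ((hp R).integrableOn_Icc).mono_set Ioc_subset_Icc_self
  have hvl := locallyIntegrableOn_Ioi hv
  obtain ⟨c, hc⟩ := ae_eq_const_of_weakDeriv_zero
    (f := fun x => v x - ∫ t in (0 : ℝ)..x, g t) (hvl.sub hpl) fun η h1 h2 h3 => by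
      have hcd : Continuous (deriv η) := h1.continuous_deriv (by simp)
      have hs : tsupport (deriv η) ⊆ Ioi 0 := tsupport_deriv_subset.trans h3
      simp_rw [mul_sub]
      rw [integral_sub (integrableOn_test_mul hvl hcd h2.deriv hs)
        (integrableOn_test_mul hpl hcd h2.deriv hs),
        h η h1 h2 h3, integral_deriv_test_mul_primitive hg h1 h2, sub_self]
  refine ⟨c, ?_⟩
  filter_upwards [hc] with x hx
  rw [← hx]; ring

theorem IsWeakDeriv.ae_unique {v g g' : ℝ → ℂ} (h : IsWeakDeriv v g) (h' : IsWeakDeriv v g')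
    (hg : LocallyIntegrableOn g (Ioi 0)) (hg' : LocallyIntegrableOn g' (Ioi 0)) :
    ∀ᵐ x ∂(volume.restrict (Ioi (0 : ℝ))), g x = g' x := by
  have := ae_eq_zero_of_test (hg.sub hg') fun η h1 h2 h3 => by
    have e := (h η h1 h2 h3).symm.trans (h' η h1 h2 h3)
    simp only [Pi.sub_apply, mul_sub]
    rw [integral_sub (integrableOn_test_mul hg h1.continuous h2 h3)
      (integrableOn_test_mul hg' h1.continuous h2 h3), neg_injective e, sub_self]
  filter_upwards [this] with x hx using sub_eq_zero.1 hx

theorem integrableOn_Ioc_of_memLp {f : ℝ → ℂ} (hf : MemLp f 2 (volume.restrict (Ioi 0))) (R : ℝ) :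
    IntegrableOn f (Ioc 0 R) :=
  (hf.mono_measure (Measure.restrict_mono (fun _ hx => hx.1) le_rfl)).integrable (by norm_num)

/-- The fundamental theorem of calculus in `H¹(0, ∞)`. -/
theorem MemH1HalfLine.eq_add_integral {v g : ℝ → ℂ} (hv : MemH1HalfLine v)
    (hg : IsL2WeakDeriv v g) {x : ℝ} (hx : 0 ≤ x) : v x = v 0 + ∫ t in (0 : ℝ)..x, g t := by
  have hgi := integrableOn_Ioc_of_memLp hg.1
  obtain ⟨c, hc⟩ := hg.2.exists_ae_eq (integrableOn_Ioc_of_memLp hv.memLp) hgi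
  -- the identity holds almost everywhere, and both sides are continuous on `[0, ∞)`
  have hp : ContinuousOn (fun x => c + ∫ t in (0 : ℝ)..x, g t) (Ici 0) := by
    refine continuousOn_const.add fun y hy => ?_
    have hy' : (0 : ℝ) ≤ y + 1 := by linarith [mem_Ici.1 hy]
    have := intervalIntegral.continuousOn_primitive_interval' (b₁ := 0) (b₂ := y + 1) (a := 0)
      ((intervalIntegrable_iff_integrableOn_Ioc_of_le hy').2 (hgi _)) (by simp)
    rw [uIcc_of_le hy'] at this
    refine (this y ⟨hy, by linarith⟩).mono_of_mem_nhdsWithin ?_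
    exact inter_mem_nhdsWithin _ (Iic_mem_nhds (by linarith))
  have heq : EqOn v (fun x => c + ∫ t in (0 : ℝ)..x, g t) (Ioi 0) := by
    refine Measure.eqOn_of_ae_eq hc (hv.continuousOn.mono Ioi_subset_Ici_self)
      (hp.mono Ioi_subset_Ici_self) ?_
    rw [interior_Ioi]; exact subset_closure
  have heq' : EqOn v (fun x => c + ∫ t in (0 : ℝ)..x, g t) (Ici 0) := by
    refine heq.of_subset_closure hv.continuousOn hp Ioi_subset_Ici_self ?_
    rw [closure_Ioi]
  have h0 := heq' (mem_Ici.2 le_rfl)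
  simp only [intervalIntegral.integral_same, add_zero] at h0
  rw [h0]; exact heq' hx

/-! ### The space `H¹` and the homogeneity of the variational problem -/

theorem integrable_norm_sq {f : ℝ → ℂ} {μ : Measure ℝ} (hf : MemLp f 2 μ) :
    Integrable (fun x => ‖f x‖ ^ 2) μ := by
  simpa using hf.integrable_norm_pow (p := 2) (by norm_num)

theorem integrable_inner_of_memLp {f g : ℝ → ℂ} {μ : Measure ℝ} (hf : MemLp f 2 μ)
    (hg : MemLp g 2 μ) : Integrable (fun x => inner ℝ (f x) (g x)) μ := by
  refine ((integrable_norm_sq hf).add (integrable_norm_sq hg)).mono'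
    (hf.1.inner hg.1) (Eventually.of_forall fun x => ?_)
  have h1 := norm_inner_le_norm (𝕜 := ℝ) (f x) (g x)
  simp only [Pi.add_apply]
  nlinarith [sq_nonneg (‖f x‖ - ‖g x‖), sq_nonneg (‖f x‖), sq_nonneg (‖g x‖)]

/-- Uses `r ≤ 1 + r ^ 2` in place of the Cauchy-Schwarz inequality. -/
theorem intervalIntegral_norm_le {f : ℝ → ℂ} (hf : MemLp f 2 (volume.restrict (Ioi 0))) {x y : ℝ}
    (hx : 0 ≤ x) (hxy : x ≤ y) (hy : y ≤ x + 1) :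
    ∫ t in x..y, ‖f t‖ ≤ 1 + ∫ t in Ioi (0 : ℝ), ‖f t‖ ^ 2 := by
  have hsub : Ioc x y ⊆ Ioi 0 := fun t ht => hx.trans_lt ht.1
  have hi : IntegrableOn (fun t => ‖f t‖ ^ 2) (Ioi 0) := integrable_norm_sq hf
  have hi1 : IntegrableOn (fun t => ‖f t‖) (Ioc x y) :=
    ((integrableOn_Ioc_of_memLp hf y).mono_set (Ioc_subset_Ioc_left hx)).norm
  rw [intervalIntegral.integral_of_le hxy]
  calc ∫ t in Ioc x y, ‖f t‖ ≤ ∫ t in Ioc x y, (1 + ‖f t‖ ^ 2) := by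
        refine setIntegral_mono hi1 ?_ fun t => ?_
        · exact (integrableOn_const (by simp)).add (hi.mono_set hsub)
        · show ‖f t‖ ≤ 1 + ‖f t‖ ^ 2
          nlinarith [sq_nonneg (‖f t‖ - 1), norm_nonneg (f t)]
    _ = (y - x) + ∫ t in Ioc x y, ‖f t‖ ^ 2 := by
        have hc : IntegrableOn (fun _ : ℝ => (1 : ℝ)) (Ioc x y) := integrableOn_const (by simp)
        rw [integral_add hc (hi.mono_set hsub)]
        simp [hxy]
    _ ≤ _ := by
        refine add_le_add (by linarith) (setIntegral_mono_set hi ?_ hsub.eventuallyLE)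
        exact Eventually.of_forall fun t => sq_nonneg _

/-- The embedding `H¹ ⊆ L^∞`: the oscillation over an interval of length one is controlled by the
`L²` norm of the derivative, and the mean by the `L²` norm of the function. -/
theorem MemH1HalfLine.exists_bound {v : ℝ → ℂ} (hv : MemH1HalfLine v) :
    ∃ C : ℝ, 0 ≤ C ∧ ∀ x, 0 ≤ x → ‖v x‖ ≤ C := by
  obtain ⟨g, hg⟩ := hv.exists_weakDeriv
  set A := 1 + ∫ t in Ioi (0 : ℝ), ‖g t‖ ^ 2
  set B := 1 + ∫ t in Ioi (0 : ℝ), ‖v t‖ ^ 2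
  have hA : 0 ≤ A := add_nonneg zero_le_one (integral_nonneg fun _ => sq_nonneg _)
  have hB : 0 ≤ B := add_nonneg zero_le_one (integral_nonneg fun _ => sq_nonneg _)
  refine ⟨B + A, by positivity, fun x hx => ?_⟩
  have hgi : ∀ a b, 0 ≤ a → a ≤ b → IntervalIntegrable g volume a b := fun a b ha hab =>
    (intervalIntegrable_iff_integrableOn_Ioc_of_le hab).2
      ((integrableOn_Ioc_of_memLp hg.1 b).mono_set (Ioc_subset_Ioc_left ha))
  have h1 : ∀ y ∈ Icc x (x + 1), ‖v x‖ ≤ ‖v y‖ + A := by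
    intro y hy
    have e : v y - v x = ∫ t in x..y, g t := by
      rw [hv.eq_add_integral hg hx, hv.eq_add_integral hg (hx.trans hy.1),
        ← intervalIntegral.integral_add_adjacent_intervals (hgi 0 x le_rfl hx)
          (hgi x y hx hy.1)]
      ring
    have e2 : ‖v y - v x‖ ≤ A := by
      rw [e]
      exact (intervalIntegral.norm_integral_le_integral_norm hy.1).trans
        (intervalIntegral_norm_le hg.1 hx hy.1 hy.2)
    have e3 := norm_sub_norm_le (v x) (v y)
    rw [norm_sub_rev] at e3
    linarith
  have hvi : IntervalIntegrable (fun t => ‖v t‖) volume x (x + 1) :=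
    ((intervalIntegrable_iff_integrableOn_Ioc_of_le (by linarith)).2
      ((integrableOn_Ioc_of_memLp hv.memLp _).mono_set (Ioc_subset_Ioc_left hx))).norm
  have h2 : ∫ _ in x..(x + 1), ‖v x‖ ≤ ∫ t in x..(x + 1), (‖v t‖ + A) :=
    intervalIntegral.integral_mono_on (by linarith) (by simp) (hvi.add (by simp)) h1
  rw [intervalIntegral.integral_add hvi (by simp)] at h2
  have h3 := intervalIntegral_norm_le hv.memLp hx (show x ≤ x + 1 by linarith) le_rfl
  simp at h2
  linarith

/-- The embedding `H¹ ⊆ L^q` for `q ≥ 2`. -/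
theorem MemH1HalfLine.integrable_rpow {v : ℝ → ℂ} (hv : MemH1HalfLine v) {q : ℝ} (hq : 2 ≤ q) :
    IntegrableOn (fun x => ‖v x‖ ^ q) (Ioi 0) := by
  obtain ⟨C, hC, hb⟩ := hv.exists_bound
  refine ((integrable_norm_sq hv.memLp).const_mul (C ^ (q - 2))).mono'
    (hv.memLp.1.norm.aemeasurable.pow_const q).aestronglyMeasurable ?_
  rw [ae_restrict_iff' measurableSet_Ioi]
  refine Eventually.of_forall fun x hx => ?_
  have h0 := norm_nonneg (v x)
  rw [Real.norm_of_nonneg (by positivity), show q = (q - 2) + 2 by ring,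
    Real.rpow_add_of_nonneg h0 (by linarith) (by norm_num), Real.rpow_two]
  rw [show q - 2 + 2 - 2 = q - 2 by ring]
  gcongr
  exact hb x (le_of_lt hx)

theorem IsL2WeakDeriv.add {v g w h : ℝ → ℂ} (hv : MemLp v 2 (volume.restrict (Ioi 0)))
    (hw : MemLp w 2 (volume.restrict (Ioi 0))) (hg : IsL2WeakDeriv v g) (hh : IsL2WeakDeriv w h) :
    IsL2WeakDeriv (fun x => v x + w x) (fun x => g x + h x) := by
  refine ⟨hg.1.add hh.1, fun η h1 h2 h3 => ?_⟩
  have L : ∀ {f : ℝ → ℂ}, MemLp f 2 (volume.restrict (Ioi 0)) → LocallyIntegrableOn f (Ioi 0) :=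
    fun hf => locallyIntegrableOn_Ioi (integrableOn_Ioc_of_memLp hf)
  have hcd : Continuous (deriv η) := h1.continuous_deriv (by simp)
  have hs : tsupport (deriv η) ⊆ Ioi 0 := tsupport_deriv_subset.trans h3
  simp_rw [mul_add]
  rw [integral_add (integrableOn_test_mul (L hv) hcd h2.deriv hs)
    (integrableOn_test_mul (L hw) hcd h2.deriv hs),
    integral_add (integrableOn_test_mul (L hg.1) h1.continuous h2 h3)
    (integrableOn_test_mul (L hh.1) h1.continuous h2 h3), hg.2 η h1 h2 h3, hh.2 η h1 h2 h3]
  ring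

theorem IsL2WeakDeriv.const_mul {v g : ℝ → ℂ} (c : ℂ) (hg : IsL2WeakDeriv v g) :
    IsL2WeakDeriv (fun x => c * v x) (fun x => c * g x) := by
  refine ⟨hg.1.const_mul c, fun η h1 h2 h3 => ?_⟩
  simp_rw [mul_left_comm _ c]
  rw [integral_const_mul, integral_const_mul, hg.2 η h1 h2 h3, mul_neg]

theorem IsL2WeakDeriv.congr {v w g : ℝ → ℂ} (h : EqOn w v (Ioi 0)) (hg : IsL2WeakDeriv v g) :
    IsL2WeakDeriv w g := by
  refine ⟨hg.1, fun η h1 h2 h3 => ?_⟩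
  rw [← hg.2 η h1 h2 h3]
  refine setIntegral_congr_fun measurableSet_Ioi fun x hx => ?_
  simp only [h hx]

theorem MemH1HalfLine.add {v w : ℝ → ℂ} (hv : MemH1HalfLine v) (hw : MemH1HalfLine w) :
    MemH1HalfLine (fun x => v x + w x) := by
  obtain ⟨g, hg⟩ := hv.exists_weakDeriv
  obtain ⟨h, hh⟩ := hw.exists_weakDeriv
  exact ⟨hv.continuousOn.add hw.continuousOn, hv.memLp.add hw.memLp,
    _, hg.add hv.memLp hw.memLp hh⟩

theorem MemH1HalfLine.const_mul {v : ℝ → ℂ} (c : ℂ) (hv : MemH1HalfLine v) :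
    MemH1HalfLine (fun x => c * v x) := by
  obtain ⟨g, hg⟩ := hv.exists_weakDeriv
  exact ⟨continuousOn_const.mul hv.continuousOn, hv.memLp.const_mul c, _, hg.const_mul c⟩

theorem MemH1HalfLine.congr {v w : ℝ → ℂ} (h : EqOn w v (Ici 0)) (hv : MemH1HalfLine v) :
    MemH1HalfLine w := by
  obtain ⟨g, hg⟩ := hv.exists_weakDeriv
  refine ⟨hv.continuousOn.congr h, hv.memLp.ae_eq ?_, g, hg.congr (h.mono Ioi_subset_Ici_self)⟩
  rw [EventuallyEq, ae_restrict_iff' measurableSet_Ioi]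
  exact Eventually.of_forall fun x hx => (h (Ioi_subset_Ici_self hx)).symm

/-- Classical derivatives are weak derivatives. -/
theorem isL2WeakDeriv_of_hasDerivAt {f f' : ℝ → ℂ} (hd : ∀ x, HasDerivAt f (f' x) x)
    (hc : Continuous f') (hf' : MemLp f' 2 (volume.restrict (Ioi 0))) : IsL2WeakDeriv f f' := by
  refine ⟨hf', fun η h1 h2 h3 => ?_⟩
  have hcf : Continuous f := continuous_iff_continuousAt.2 fun x => (hd x).continuousAt
  have hcd : Continuous (deriv η) := h1.continuous_deriv (by simp)
  have hdη : ∀ x, HasDerivAt (fun x => ((η x : ℝ) : ℂ)) ((deriv η x : ℝ) : ℂ) x := fun x =>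
    ((h1.differentiable (by simp)) x).hasDerivAt.ofReal_comp
  have i1 : Integrable (fun x => ((η x : ℝ) : ℂ) * f' x) :=
    ((Complex.continuous_ofReal.comp h1.continuous).mul hc).integrable_of_hasCompactSupport
      (h2.comp_left (g := Complex.ofReal) (by simp)).mul_right
  have i2 : Integrable (fun x => ((deriv η x : ℝ) : ℂ) * f x) :=
    ((Complex.continuous_ofReal.comp hcd).mul hcf).integrable_of_hasCompactSupport
      (h2.deriv.comp_left (g := Complex.ofReal) (by simp)).mul_right
  have i3 : Integrable (fun x => ((η x : ℝ) : ℂ) * f x) :=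
    ((Complex.continuous_ofReal.comp h1.continuous).mul hcf).integrable_of_hasCompactSupport
      (h2.comp_left (g := Complex.ofReal) (by simp)).mul_right
  have h := integral_mul_deriv_eq_deriv_mul_of_integrable (fun x _ => hdη x) (fun x _ => hd x)
    i1 i2 i3
  have z : ∀ x ∉ Ioi (0 : ℝ), x ∉ tsupport η := fun x hx h => hx (h3 h)
  rw [setIntegral_eq_integral_of_forall_compl_eq_zero,
    setIntegral_eq_integral_of_forall_compl_eq_zero,
    h, neg_neg]
  · intro x hx
    rw [image_eq_zero_of_notMem_tsupport (z x hx)]; simp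
  · intro x hx
    rw [image_eq_zero_of_notMem_tsupport fun h => z x hx (tsupport_deriv_subset h)]; simp

theorem isL2WeakDeriv_weakDeriv {v : ℝ → ℂ} (h : ∃ g, IsL2WeakDeriv v g) :
    IsL2WeakDeriv v (weakDeriv v) := by
  rw [weakDeriv, dif_pos h]; exact h.choose_spec

theorem IsL2WeakDeriv.weakDeriv_ae_eq {v g : ℝ → ℂ} (h : IsL2WeakDeriv v g) :
    ∀ᵐ x ∂(volume.restrict (Ioi (0 : ℝ))), weakDeriv v x = g x := by
  have h' := isL2WeakDeriv_weakDeriv ⟨g, h⟩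
  exact h'.2.ae_unique h.2 (locallyIntegrableOn_Ioi (integrableOn_Ioc_of_memLp h'.1))
    (locallyIntegrableOn_Ioi (integrableOn_Ioc_of_memLp h.1))


/-- The quadratic part `F_β(v) + ω ‖v‖₂²` of the action. -/
def linForm (β ω : ℝ) (v : Fin N → ℝ → ℂ) : ℝ :=
  quadForm β v + ω * lpNormPow 2 v

/-- The quadratic part computed with any choice of `L²` weak derivatives. -/
theorem linForm_eq {β ω : ℝ} {v g : Fin N → ℝ → ℂ} (hg : ∀ j, IsL2WeakDeriv (v j) (g j)) :
    linForm β ω v = ∑ j, (∫ x in Ioi (0 : ℝ), ‖g j x‖ ^ 2) + 1 / β * ‖∑ j, v j 0‖ ^ 2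
      + ω * ∑ j, ∫ x in Ioi (0 : ℝ), ‖v j x‖ ^ 2 := by
  have : ∀ j, ∫ x in Ioi (0 : ℝ), ‖weakDeriv (v j) x‖ ^ 2 = ∫ x in Ioi (0 : ℝ), ‖g j x‖ ^ 2 :=
    fun j => integral_congr_ae (by
      filter_upwards [(hg j).weakDeriv_ae_eq] with x hx
      rw [hx])
  simp only [linForm, quadForm, lpNormPow, Real.rpow_two, this]

theorem nehari_eq (p β ω : ℝ) (v : Fin N → ℝ → ℂ) :
    nehari p β ω v = linForm β ω v - lpNormPow (p + 1) v := rfl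

theorem action_eq_of_nehari {p β ω : ℝ} (hp : 1 < p) {v : Fin N → ℝ → ℂ}
    (h : nehari p β ω v = 0) :
    action p β ω v = (p - 1) / (2 * (p + 1)) * lpNormPow (p + 1) v := by
  rw [nehari] at h
  have : quadForm β v = lpNormPow (p + 1) v - ω * lpNormPow 2 v := by linarith
  rw [action, this]
  have : p + 1 ≠ 0 := by linarith
  field_simp
  ring

theorem lpNormPow_nonneg (q : ℝ) (v : Fin N → ℝ → ℂ) : 0 ≤ lpNormPow q v :=
  Finset.sum_nonneg fun _ _ => integral_nonneg fun _ => by positivity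

/-- Integrability matters here: the integral of a non-integrable function would be `0`. -/
theorem lpNormPow_pos {q : ℝ} (hq : 2 ≤ q) {v : Fin N → ℝ → ℂ} (hv : MemH1 v)
    (h0 : ∃ j, ∃ x : ℝ, 0 ≤ x ∧ v j x ≠ 0) : 0 < lpNormPow q v := by
  obtain ⟨j, x, hx, hvx⟩ := h0
  refine Finset.sum_pos' (fun _ _ => integral_nonneg fun _ => by positivity)
    ⟨j, Finset.mem_univ j, ?_⟩
  rw [integral_pos_iff_support_of_nonneg (fun _ => by positivity) ((hv j).integrable_rpow hq)]
  -- continuity on `[0, ∞)` gives a nonempty open subset of `(0, ∞)` on which `v j` is nonzero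
  have hopen : IsOpen (Ioi 0 ∩ (v j) ⁻¹' {0}ᶜ) :=
    ((hv j).continuousOn.mono Ioi_subset_Ici_self).isOpen_inter_preimage isOpen_Ioi
      isOpen_compl_singleton
  have hne : (Ioi 0 ∩ (v j) ⁻¹' {0}ᶜ).Nonempty := by
    by_contra hem
    rw [not_nonempty_iff_eq_empty] at hem
    have hz : EqOn (v j) 0 (Ioi 0) := fun y hy => by
      by_contra hne
      exact (hem ▸ (⟨hy, hne⟩ : y ∈ Ioi 0 ∩ (v j) ⁻¹' {0}ᶜ) : y ∈ (∅ : Set ℝ))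
    have := hz.of_subset_closure (hv j).continuousOn continuousOn_const Ioi_subset_Ici_self
      (by rw [closure_Ioi])
    exact hvx (this hx)
  refine (hopen.measure_pos volume hne).trans_le ?_
  rw [Measure.restrict_apply₀']
  · refine measure_mono fun y hy => ⟨?_, hy.1⟩
    have : 0 < ‖v j y‖ := norm_pos_iff.2 hy.2
    exact (Real.rpow_pos_of_pos this q).ne'
  · exact measurableSet_Ioi.nullMeasurableSet

theorem lpNormPow_const_mul {q l : ℝ} (hl : 0 ≤ l) (v : Fin N → ℝ → ℂ) :
    lpNormPow q (fun j x => (l : ℂ) * v j x) = l ^ q * lpNormPow q v := by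
  simp only [lpNormPow, norm_mul, Complex.norm_real, Real.norm_of_nonneg hl,
    Real.mul_rpow hl (norm_nonneg _), integral_const_mul, Finset.mul_sum]

theorem linForm_const_mul {β ω : ℝ} (l : ℝ) {v : Fin N → ℝ → ℂ} (hv : MemH1 v) :
    linForm β ω (fun j x => (l : ℂ) * v j x) = l ^ 2 * linForm β ω v := by
  have hg := fun j => isL2WeakDeriv_weakDeriv (hv j).exists_weakDeriv
  rw [linForm_eq hg, linForm_eq fun j => (hg j).const_mul (l : ℂ)]
  simp only [norm_mul, mul_pow, integral_const_mul, ← Finset.mul_sum, Complex.norm_real,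
    Real.norm_eq_abs, sq_abs]
  ring

/-- By homogeneity, a minimizer `v` on the Nehari manifold minimizes the quotient
`(F_β + ω ‖·‖₂²)^(p+1) / ‖·‖_{p+1}^{2(p+1)}` among all functions with positive quadratic part. -/
theorem IsNehariMinimizer.le_linForm {p β ω : ℝ} (hp : 1 < p) {v : Fin N → ℝ → ℂ}
    (hv : IsNehariMinimizer p β ω v) {w : Fin N → ℝ → ℂ} (hw : MemH1 w)
    (hpos : 0 < linForm β ω w) :
    lpNormPow (p + 1) v ^ (p - 1) * lpNormPow (p + 1) w ^ 2 ≤ linForm β ω w ^ (p + 1) := by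
  rcases (lpNormPow_nonneg (p + 1) w).eq_or_lt with hP | hP
  · rw [← hP]; simp only [ne_eq, OfNat.ofNat_ne_zero, not_false_eq_true, zero_pow, mul_zero]
    positivity
  set P := lpNormPow (p + 1) w
  set B := linForm β ω w
  have hw0 : ∃ j, ∃ x : ℝ, 0 ≤ x ∧ w j x ≠ 0 := by
    by_contra hcon
    push Not at hcon
    have : P = 0 := Finset.sum_eq_zero fun j _ => by
      refine (setIntegral_congr_fun (g := fun _ => (0 : ℝ)) measurableSet_Ioi fun x hx => ?_).trans
        (by simp)
      simp only [hcon j x (le_of_lt hx), norm_zero]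
      exact Real.zero_rpow (by linarith)
    exact hP.ne' this
  -- the factor that moves `w` onto the Nehari manifold
  set l := (B / P) ^ (1 / (p - 1))
  have hl : 0 < l := Real.rpow_pos_of_pos (div_pos hpos hP) _
  have hp1 : p - 1 ≠ 0 := by linarith
  have hlp : l ^ (p - 1) = B / P := by
    rw [← Real.rpow_mul (div_pos hpos hP).le, one_div_mul_cancel hp1, Real.rpow_one]
  have hmem : (fun j x => (l : ℂ) * w j x) ∈ nehariSet N p β ω := by
    refine ⟨fun j => (hw j).const_mul _, ?_, ?_⟩
    · obtain ⟨j, x, hx, hne⟩ := hw0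
      exact ⟨j, x, hx, mul_ne_zero (by exact_mod_cast hl.ne') hne⟩
    · rw [nehari_eq, linForm_const_mul l hw, lpNormPow_const_mul hl.le,
        show p + 1 = (p - 1) + 2 by ring, Real.rpow_add hl, hlp, Real.rpow_two,
        show p - 1 + 2 = p + 1 by ring]
      change l ^ 2 * B - B / P * l ^ 2 * P = 0
      field_simp
      ring
  have hmin := hv.2 hmem
  simp only [mem_ofPred_eq] at hmin
  rw [action_eq_of_nehari hp hv.1.2.2, action_eq_of_nehari hp hmem.2.2,
    lpNormPow_const_mul hl.le] at hmin
  have hc : 0 < (p - 1) / (2 * (p + 1)) := div_pos (by linarith) (by linarith)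
  have h1 := le_of_mul_le_mul_left hmin hc
  have h2 := Real.rpow_le_rpow (lpNormPow_nonneg _ _) h1 (by linarith : 0 ≤ p - 1)
  calc lpNormPow (p + 1) v ^ (p - 1) * P ^ 2
      ≤ (l ^ (p + 1) * P) ^ (p - 1) * P ^ 2 := by gcongr
    _ = B ^ (p + 1) := by
      rw [Real.mul_rpow (by positivity) hP.le, ← Real.rpow_mul hl.le, mul_comm (p + 1),
        Real.rpow_mul hl.le, hlp, Real.div_rpow hpos.le hP.le, ← Real.rpow_two, mul_assoc,
        ← Real.rpow_add hP, show p - 1 + 2 = p + 1 by ring]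
      have := Real.rpow_pos_of_pos hP (p + 1)
      field_simp

/-! ### The Euler-Lagrange equation -/

/-- The tangent hyperplane bound for the convex function `‖·‖ ^ q`. -/
theorem norm_rpow_add_ge {q : ℝ} (hq : 2 ≤ q) (a b : ℂ) :
    ‖a‖ ^ q + q * (‖a‖ ^ (q - 2) * inner ℝ a b) ≤ ‖a + b‖ ^ q := by
  rcases eq_or_ne a 0 with rfl | ha
  · simp only [norm_zero, inner_zero_left, mul_zero, add_zero, zero_add]
    rw [Real.zero_rpow (by linarith)]
    positivity
  have hy : 0 < ‖a‖ := norm_pos_iff.2 ha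
  have h1 : inner ℝ a b ≤ ‖a‖ * ‖a + b‖ - ‖a‖ ^ 2 := by
    have h := real_inner_le_norm a (a + b)
    rw [inner_add_right, real_inner_self_eq_norm_sq] at h
    linarith
  have h2 := one_add_mul_self_le_rpow_one_add (s := ‖a + b‖ / ‖a‖ - 1) (p := q)
    (by linarith [div_nonneg (norm_nonneg (a + b)) hy.le]) (by linarith)
  rw [add_sub_cancel, Real.div_rpow (norm_nonneg _) hy.le, le_div_iff₀ (by positivity)] at h2
  have h3 : ‖a‖ ^ q = ‖a‖ ^ (q - 2) * ‖a‖ ^ 2 := by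
    rw [← Real.rpow_two, ← Real.rpow_add hy]; congr 1; ring
  calc _ ≤ ‖a‖ ^ q + q * (‖a‖ ^ (q - 2) * (‖a‖ * ‖a + b‖ - ‖a‖ ^ 2)) := by gcongr
    _ = (1 + q * (‖a + b‖ / ‖a‖ - 1)) * ‖a‖ ^ q := by
      rw [h3]; field_simp
    _ ≤ _ := h2

theorem integrable_rpow_mul_inner {v h : ℝ → ℂ} (hv : MemH1HalfLine v)
    (hh : MemLp h 2 (volume.restrict (Ioi 0))) {r : ℝ} (hr : 0 ≤ r) :
    IntegrableOn (fun x => ‖v x‖ ^ r * inner ℝ (v x) (h x)) (Ioi 0) := by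
  obtain ⟨C, hC, hb⟩ := hv.exists_bound
  refine (integrable_inner_of_memLp hv.memLp hh).bdd_mul (c := C ^ r)
    (hv.memLp.1.norm.aemeasurable.pow_const r).aestronglyMeasurable ?_
  rw [ae_restrict_iff' measurableSet_Ioi]
  refine Eventually.of_forall fun x hx => ?_
  rw [Real.norm_of_nonneg (by positivity)]
  exact Real.rpow_le_rpow (norm_nonneg _) (hb x (le_of_lt hx)) hr

theorem MemH1.add_mul {v h : Fin N → ℝ → ℂ} (hv : MemH1 v) (hh : MemH1 h) (s : ℝ) :
    MemH1 (fun j x => v j x + (s : ℂ) * h j x) := fun j => (hv j).add ((hh j).const_mul _)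

/-- First order lower bound for the convex functional `lpNormPow q`. -/
theorem lpNormPow_add_ge {q : ℝ} (hq : 2 ≤ q) {v h : Fin N → ℝ → ℂ} (hv : MemH1 v)
    (hh : MemH1 h) (s : ℝ) :
    lpNormPow q v + s * q * ∑ j, ∫ x in Ioi (0 : ℝ), ‖v j x‖ ^ (q - 2) * inner ℝ (v j x) (h j x)
      ≤ lpNormPow q (fun j x => v j x + (s : ℂ) * h j x) := by
  rw [lpNormPow, lpNormPow, Finset.mul_sum, ← Finset.sum_add_distrib]
  refine Finset.sum_le_sum fun j _ => ?_
  have i1 := (hv j).integrable_rpow hq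
  have i2 := (integrable_rpow_mul_inner (hv j) (hh j).memLp
    (show (0 : ℝ) ≤ q - 2 by linarith)).const_mul (s * q)
  rw [← integral_const_mul, ← integral_add i1 i2]
  refine integral_mono (i1.add i2) ((hv.add_mul hh s j).integrable_rpow hq) fun x => ?_
  have := norm_rpow_add_ge hq (v j x) ((s : ℂ) * h j x)
  rw [← Complex.real_smul, inner_smul_right, Complex.real_smul] at this
  refine le_trans (le_of_eq ?_) this
  ring

theorem integral_norm_add_sq {f g : ℝ → ℂ} {μ : Measure ℝ} (hf : MemLp f 2 μ) (hg : MemLp g 2 μ)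
    (s : ℝ) : ∫ x, ‖f x + (s : ℂ) * g x‖ ^ 2 ∂μ =
      (∫ x, ‖f x‖ ^ 2 ∂μ) + 2 * s * (∫ x, inner ℝ (f x) (g x) ∂μ) + s ^ 2 * ∫ x, ‖g x‖ ^ 2 ∂μ := by
  have i1 := integrable_norm_sq hf
  have i2 := (integrable_inner_of_memLp hf hg).const_mul (2 * s)
  have i3 := (integrable_norm_sq hg).const_mul (s ^ 2)
  have i12 : Integrable (fun x => ‖f x‖ ^ 2 + 2 * s * inner ℝ (f x) (g x)) μ := i1.add i2
  rw [← integral_const_mul, ← integral_const_mul, ← integral_add i1 i2, ← integral_add i12 i3]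
  refine integral_congr_ae (Eventually.of_forall fun x => ?_)
  simp only
  rw [← Complex.real_smul, norm_add_sq_real, inner_smul_right, norm_smul, mul_pow,
    Real.norm_eq_abs, sq_abs]
  ring

/-- The quadratic part of the action along a line. -/
theorem linForm_add_mul {β ω : ℝ} {v g h k : Fin N → ℝ → ℂ} (hv : MemH1 v) (hh : MemH1 h)
    (hg : ∀ j, IsL2WeakDeriv (v j) (g j)) (hk : ∀ j, IsL2WeakDeriv (h j) (k j)) (s : ℝ) :
    linForm β ω (fun j x => v j x + (s : ℂ) * h j x) = linForm β ω v
      + 2 * s * (∑ j, (∫ x in Ioi (0 : ℝ), inner ℝ (g j x) (k j x))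
        + 1 / β * inner ℝ (∑ j, v j 0) (∑ j, h j 0)
        + ω * ∑ j, ∫ x in Ioi (0 : ℝ), inner ℝ (v j x) (h j x))
      + s ^ 2 * linForm β ω h := by
  have hw := fun j => (hg j).add (hv j).memLp ((hh j).memLp.const_mul (s : ℂ))
    ((hk j).const_mul (s : ℂ))
  rw [linForm_eq hg, linForm_eq hk, linForm_eq hw]
  have e1 := fun j => integral_norm_add_sq (hg j).1 (hk j).1 s
  have e2 := fun j => integral_norm_add_sq (hv j).memLp (hh j).memLp s
  have e3 : ‖∑ j, (v j 0 + (s : ℂ) * h j 0)‖ ^ 2 = ‖∑ j, v j 0‖ ^ 2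
      + 2 * s * inner ℝ (∑ j, v j 0) (∑ j, h j 0) + s ^ 2 * ‖∑ j, h j 0‖ ^ 2 := by
    rw [Finset.sum_add_distrib, ← Finset.mul_sum, ← Complex.real_smul, norm_add_sq_real,
      inner_smul_right, norm_smul, mul_pow, Real.norm_eq_abs, sq_abs]
    ring
  simp only [e1, e2, e3]
  simp only [Finset.sum_add_distrib, ← Finset.mul_sum]
  ring

theorem IsNehariMinimizer.linForm_eq_lpNormPow {p β ω : ℝ} {v : Fin N → ℝ → ℂ}
    (hv : IsNehariMinimizer p β ω v) : linForm β ω v = lpNormPow (p + 1) v := by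
  have := hv.1.2.2
  rw [nehari_eq] at this
  linarith

theorem IsNehariMinimizer.lpNormPow_pos {p β ω : ℝ} (hp : 1 < p) {v : Fin N → ℝ → ℂ}
    (hv : IsNehariMinimizer p β ω v) : 0 < lpNormPow (p + 1) v :=
  StarGraph.lpNormPow_pos (by linarith) hv.1.1 hv.1.2.1

/-- The Euler-Lagrange equation of a minimizer, in weak form. The Lagrange multiplier vanishes
because the constraint is natural. -/
theorem IsNehariMinimizer.euler_lagrange {p β ω : ℝ} (hp : 1 < p) {v g h k : Fin N → ℝ → ℂ}
    (hv : IsNehariMinimizer p β ω v) (hh : MemH1 h)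
    (hg : ∀ j, IsL2WeakDeriv (v j) (g j)) (hk : ∀ j, IsL2WeakDeriv (h j) (k j)) :
    ∑ j, (∫ x in Ioi (0 : ℝ), inner ℝ (g j x) (k j x))
        + 1 / β * inner ℝ (∑ j, v j 0) (∑ j, h j 0)
        + ω * ∑ j, ∫ x in Ioi (0 : ℝ), inner ℝ (v j x) (h j x)
      = ∑ j, ∫ x in Ioi (0 : ℝ), ‖v j x‖ ^ (p - 1) * inner ℝ (v j x) (h j x) := by
  set K := ∑ j, (∫ x in Ioi (0 : ℝ), inner ℝ (g j x) (k j x))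
        + 1 / β * inner ℝ (∑ j, v j 0) (∑ j, h j 0)
        + ω * ∑ j, ∫ x in Ioi (0 : ℝ), inner ℝ (v j x) (h j x) with hK
  set L := ∑ j, ∫ x in Ioi (0 : ℝ), ‖v j x‖ ^ (p - 1) * inner ℝ (v j x) (h j x) with hL
  set M := lpNormPow (p + 1) v with hM
  have hM0 : 0 < M := hv.lpNormPow_pos hp
  set C := linForm β ω h
  have hB : ∀ s : ℝ, linForm β ω (fun j x => v j x + (s : ℂ) * h j x)
      = M + 2 * s * K + s ^ 2 * C := fun s => by
    rw [linForm_add_mul hv.1.1 hh hg hk, hv.linForm_eq_lpNormPow]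
  have hP : ∀ s : ℝ, M + s * (p + 1) * L
      ≤ lpNormPow (p + 1) (fun j x => v j x + (s : ℂ) * h j x) := fun s => by
    have := lpNormPow_add_ge (q := p + 1) (by linarith) hv.1.1 hh s
    rwa [show p + 1 - 2 = p - 1 by ring] at this
  have hcB : Tendsto (fun s : ℝ => M + 2 * s * K + s ^ 2 * C) (𝓝 0) (𝓝 M) := by
    have : Continuous (fun s : ℝ => M + 2 * s * K + s ^ 2 * C) := by fun_prop
    simpa using this.tendsto 0
  have hcP : Tendsto (fun s : ℝ => M + s * (p + 1) * L) (𝓝 0) (𝓝 M) := by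
    have : Continuous (fun s : ℝ => M + s * (p + 1) * L) := by fun_prop
    simpa using this.tendsto 0
  -- this nonnegative function of `s` vanishes at `0`; its derivative there is a multiple of `K - L`
  have hmin : IsLocalMin (fun s : ℝ => (M + 2 * s * K + s ^ 2 * C) ^ (p + 1)
      - M ^ (p - 1) * (M + s * (p + 1) * L) ^ 2) 0 := by
    filter_upwards [hcB.eventually (lt_mem_nhds hM0), hcP.eventually (lt_mem_nhds hM0)] with s h1 h2
    have key := hv.le_linForm hp (hv.1.1.add_mul hh s) (by rw [hB]; exact h1)
    rw [hB] at key
    have h3 : M ^ (p - 1) * (M + s * (p + 1) * L) ^ 2 ≤ (M + 2 * s * K + s ^ 2 * C) ^ (p + 1) := by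
      refine le_trans ?_ key
      gcongr
      exact hP s
    have h0 : (M + 2 * 0 * K + 0 ^ 2 * C) ^ (p + 1)
        - M ^ (p - 1) * (M + 0 * (p + 1) * L) ^ 2 = 0 := by
      rw [show M + 2 * 0 * K + 0 ^ 2 * C = M by ring, show M + 0 * (p + 1) * L = M by ring,
        ← Real.rpow_two, ← Real.rpow_add hM0, show p - 1 + 2 = p + 1 by ring, sub_self]
    rw [h0]
    linarith
  have d1 : HasDerivAt (fun s : ℝ => M + 2 * s * K + s ^ 2 * C) (2 * K) 0 := by
    have e1 : HasDerivAt (fun s : ℝ => 2 * s * K) (2 * 1 * K) 0 :=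
      ((hasDerivAt_id (0 : ℝ)).const_mul 2).mul_const K
    have e2 : HasDerivAt (fun s : ℝ => s ^ 2 * C) _ 0 := (hasDerivAt_pow 2 (0 : ℝ)).mul_const C
    exact ((e1.const_add M).fun_add e2).congr_deriv (by simp)
  have d2 : HasDerivAt (fun s : ℝ => M + s * (p + 1) * L) ((p + 1) * L) 0 := by
    have e1 : HasDerivAt (fun s : ℝ => s * (p + 1) * L) (1 * (p + 1) * L) 0 :=
      ((hasDerivAt_id (0 : ℝ)).mul_const (p + 1)).mul_const L
    exact (e1.const_add M).congr_deriv (by ring)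
  have d3 := (d1.rpow_const (p := p + 1) (Or.inl (by simpa using hM0.ne'))).sub
    ((d2.pow 2).const_mul (M ^ (p - 1)))
  have hz := hmin.hasDerivAt_eq_zero d3
  simp only [mul_zero, zero_mul, add_zero, ne_eq, OfNat.ofNat_ne_zero, not_false_eq_true, zero_pow,
    add_sub_cancel_right, Nat.add_one_sub_one, pow_one] at hz
  have e : M ^ p = M ^ (p - 1) * M := by
    conv_rhs => rw [← Real.rpow_one M, ← Real.rpow_mul hM0.le, one_mul]
    rw [← Real.rpow_add hM0]; congr 1; ring
  rw [e] at hz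
  have hpos : 0 < M ^ (p - 1) * M * (2 * (p + 1)) := by positivity
  have : M ^ (p - 1) * M * (2 * (p + 1)) * (K - L) = 0 := by
    push_cast at hz
    linarith
  rcases mul_eq_zero.1 this with h | h
  · exact absurd h hpos.ne'
  · linarith

/-- `v` is an `H¹` solution of the stationary equation `v'' = ω v - |v|^(p-1) v` on `(0, ∞)`, and
`G` is its derivative. Both are continuous up to the endpoint `0`. -/
structure IsEdgeSolution (p ω : ℝ) (v G : ℝ → ℂ) : Prop where
  memH1 : MemH1HalfLine v
  cont' : ContinuousOn G (Ici 0)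
  deriv : ∀ x, 0 < x → HasDerivAt v (G x) x
  deriv' : ∀ x, 0 < x → HasDerivAt G ((ω : ℂ) * v x - ((‖v x‖ ^ (p - 1) : ℝ) : ℂ) * v x) x
  memLp' : MemLp G 2 (volume.restrict (Ioi 0))

theorem memLp_of_hasCompactSupport {η : ℝ → ℝ} (h1 : Continuous η) (h2 : HasCompactSupport η) :
    MemLp (fun x => ((η x : ℝ) : ℂ)) 2 (volume.restrict (Ioi 0)) :=
  ((Complex.continuous_ofReal.comp h1).memLp_of_hasCompactSupport
    (h2.comp_left (g := Complex.ofReal) (by simp))).restrict _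

theorem integrable_mul_of_memLp {f g : ℝ → ℂ} {μ : Measure ℝ} (hf : MemLp f 2 μ)
    (hg : MemLp g 2 μ) : Integrable (fun x => f x * g x) μ := hf.integrable_mul hg

/-- The Euler-Lagrange equation tested with functions supported on a single edge. These may be
nonzero at the vertex, so that the coupling condition appears as well. -/
theorem IsNehariMinimizer.euler_lagrange_edge {p β ω : ℝ} (hp : 1 < p) {v g : Fin N → ℝ → ℂ}
    (hv : IsNehariMinimizer p β ω v) (hg : ∀ j, IsL2WeakDeriv (v j) (g j)) {η : ℝ → ℝ}
    (h1 : ContDiff ℝ (⊤ : ℕ∞) η) (h2 : HasCompactSupport η) (j : Fin N) :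
    ∫ x in Ioi (0 : ℝ), ((deriv η x : ℝ) : ℂ) * g j x =
      - (∫ x in Ioi (0 : ℝ), ((η x : ℝ) : ℂ) *
          ((ω : ℂ) * v j x - ((‖v j x‖ ^ (p - 1) : ℝ) : ℂ) * v j x))
        - ((η 0 : ℝ) : ℂ) * ((1 / β : ℝ) * ∑ i, v i 0) := by
  have hcd : Continuous (deriv η) := h1.continuous_deriv (by simp)
  have hη := memLp_of_hasCompactSupport h1.continuous h2
  have hη' := memLp_of_hasCompactSupport hcd h2.deriv
  have hηw : IsL2WeakDeriv (fun x => ((η x : ℝ) : ℂ)) (fun x => ((deriv η x : ℝ) : ℂ)) :=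
    isL2WeakDeriv_of_hasDerivAt
      (fun x => ((h1.differentiable (by simp)) x).hasDerivAt.ofReal_comp)
      (Complex.continuous_ofReal.comp hcd) hη'
  have i1 := fun i => integrable_mul_of_memLp hη' (hg i).1
  have i2 := fun i => integrable_mul_of_memLp hη (hv.1.1 i).memLp
  have i3 : ∀ i, IntegrableOn (fun x => ((η x : ℝ) : ℂ) * (((‖v i x‖ ^ (p - 1) : ℝ) : ℂ) * v i x))
      (Ioi 0) := fun i => by
    obtain ⟨C, hC, hb⟩ := (hv.1.1 i).exists_bound
    have : Integrable (fun x => ((‖v i x‖ ^ (p - 1) : ℝ) : ℂ) * (((η x : ℝ) : ℂ) * v i x))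
        (volume.restrict (Ioi 0)) := by
      refine (i2 i).bdd_mul (c := C ^ (p - 1)) ?_ ?_
      · exact (Complex.measurable_ofReal.comp_aemeasurable
          ((hv.1.1 i).memLp.1.norm.aemeasurable.pow_const (p - 1))).aestronglyMeasurable
      · rw [ae_restrict_iff' measurableSet_Ioi]
        refine Eventually.of_forall fun x hx => ?_
        rw [Complex.norm_real, Real.norm_of_nonneg (by positivity)]
        exact Real.rpow_le_rpow (norm_nonneg _) (hb x (le_of_lt hx)) (by linarith)
    refine this.congr (Eventually.of_forall fun x => ?_)
    simp only; ring
  set X : Fin N → ℂ := fun i => (∫ x in Ioi (0 : ℝ), ((deriv η x : ℝ) : ℂ) * g i x)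
    + (ω : ℂ) * (∫ x in Ioi (0 : ℝ), ((η x : ℝ) : ℂ) * v i x)
    + ((η 0 : ℝ) : ℂ) * ((1 / β : ℝ) * ∑ i, v i 0)
    - ∫ x in Ioi (0 : ℝ), ((η x : ℝ) : ℂ) * (((‖v i x‖ ^ (p - 1) : ℝ) : ℂ) * v i x) with hX
  -- testing with `X i • η` on the `i`-th edge gives `∑ i, ‖X i‖ ^ 2 = 0`
  have hEL := hv.euler_lagrange hp (h := fun i x => X i * ((η x : ℝ) : ℂ))
    (k := fun i x => X i * ((deriv η x : ℝ) : ℂ))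
    (fun i => MemH1HalfLine.const_mul (X i)
      ⟨(Complex.continuous_ofReal.comp h1.continuous).continuousOn, hη, _, hηw⟩)
    hg (fun i => hηw.const_mul (X i))
  have e0 : ∀ (a c : ℂ) (r : ℝ),
      inner ℝ a (c * (r : ℂ)) = inner ℝ c ((r : ℂ) * a) := fun a c r => by
    rw [mul_comm c, ← Complex.real_smul, ← Complex.real_smul, inner_smul_right, inner_smul_right,
      real_inner_comm]
  have e3 : ∀ (a c : ℂ) (r l : ℝ), l * inner ℝ a (c * (r : ℂ))
      = inner ℝ c ((r : ℂ) * ((l : ℂ) * a)) := fun a c r l => by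
    rw [e0, ← inner_smul_right, Complex.real_smul]
    congr 1; ring
  simp only [e3] at hEL
  simp only [e0] at hEL
  simp only [integral_inner (i1 _), integral_inner (i2 _), integral_inner (i3 _)] at hEL
  rw [← Finset.sum_mul, e0, sum_inner, Finset.mul_sum _ _ (1 / β), Finset.mul_sum _ _ ω,
    ← Finset.sum_add_distrib,
    ← Finset.sum_add_distrib, ← sub_eq_zero, ← Finset.sum_sub_distrib] at hEL
  have hsum : ∑ i, ‖X i‖ ^ 2 = 0 := by
    rw [← hEL]
    refine Finset.sum_congr rfl fun i _ => ?_
    rw [← real_inner_self_eq_norm_sq]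
    have hXi := congrFun hX i
    generalize X i = c at hXi ⊢
    conv_lhs => arg 3; rw [hXi]
    rw [inner_sub_right, inner_add_right, inner_add_right, ← Complex.real_smul (x := ω),
      inner_smul_right, show ((η 0 : ℝ) : ℂ) * (((1 / β : ℝ) : ℂ) * ∑ i, v i 0)
        = (1 / β : ℝ) • (((η 0 : ℝ) : ℂ) * ∑ i, v i 0) by rw [Complex.real_smul]; ring,
      inner_smul_right]
    ring
  have hXj : X j = 0 := by
    have := (Finset.sum_eq_zero_iff_of_nonneg fun i _ => sq_nonneg ‖X i‖).1 hsum j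
      (Finset.mem_univ j)
    simpa using this
  simp only [hX] at hXj
  have e4 : ∫ x in Ioi (0 : ℝ), ((η x : ℝ) : ℂ) *
      ((ω : ℂ) * v j x - ((‖v j x‖ ^ (p - 1) : ℝ) : ℂ) * v j x)
      = (ω : ℂ) * (∫ x in Ioi (0 : ℝ), ((η x : ℝ) : ℂ) * v j x)
        - ∫ x in Ioi (0 : ℝ), ((η x : ℝ) : ℂ) * (((‖v j x‖ ^ (p - 1) : ℝ) : ℂ) * v j x) := by
    rw [← integral_const_mul, ← integral_sub ((i2 j).const_mul _) (i3 j)]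
    refine integral_congr_ae (Eventually.of_forall fun x => ?_)
    simp only; ring
  rw [e4]
  linear_combination hXj

theorem hasDerivAt_integral_of_continuousOn {f : ℝ → ℂ} (hf : ContinuousOn f (Ici 0)) {x : ℝ}
    (hx : 0 < x) : HasDerivAt (fun y => ∫ t in (0 : ℝ)..y, f t) (f x) x := by
  refine intervalIntegral.integral_hasDerivAt_right ?_ ?_ ?_
  · exact (hf.mono (by rw [uIcc_of_le hx.le]; exact Icc_subset_Ici_self)).intervalIntegrable
  · exact ContinuousOn.stronglyMeasurableAtFilter isOpen_Ioi (hf.mono Ioi_subset_Ici_self) x hx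
  · exact hf.continuousAt (Ici_mem_nhds hx)

theorem continuousOn_integral {f : ℝ → ℂ} (hf : ContinuousOn f (Ici 0)) :
    ContinuousOn (fun y => ∫ t in (0 : ℝ)..y, f t) (Ici 0) := by
  intro y hy
  have hy' : (0 : ℝ) ≤ y + 1 := by linarith [mem_Ici.1 hy]
  have := intervalIntegral.continuousOn_primitive_interval' (b₁ := 0) (b₂ := y + 1) (a := 0)
    (f := f) (μ := volume)
    ((hf.mono (by rw [uIcc_of_le hy']; exact Icc_subset_Ici_self)).intervalIntegrable) (by simp)
  rw [uIcc_of_le hy'] at this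
  refine (this y ⟨hy, by linarith⟩).mono_of_mem_nhdsWithin ?_
  exact inter_mem_nhdsWithin _ (Iic_mem_nhds (by linarith))

/-- On every edge a minimizer is a classical solution of the stationary equation, and all its
derivatives at the vertex agree with `1/β` times the sum of its values there. -/
theorem IsNehariMinimizer.exists_isEdgeSolution {p β ω : ℝ} (hp : 1 < p) {v : Fin N → ℝ → ℂ}
    (hv : IsNehariMinimizer p β ω v) :
    ∃ G : Fin N → ℝ → ℂ, ∀ j, IsEdgeSolution p ω (v j) (G j) ∧
      G j 0 = (1 / β : ℝ) * ∑ i, v i 0 := by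
  choose g hg using fun j => (hv.1.1 j).exists_weakDeriv
  -- `F j` is a weak derivative of `g j`, so `g j` has the `C¹` representative `G j`
  set F : Fin N → ℝ → ℂ := fun j x => (ω : ℂ) * v j x - ((‖v j x‖ ^ (p - 1) : ℝ) : ℂ) * v j x
    with hF
  have hFc : ∀ j, ContinuousOn (F j) (Ici 0) := fun j => by
    have h := (hv.1.1 j).continuousOn
    refine (continuousOn_const.mul h).sub (ContinuousOn.mul ?_ h)
    exact Complex.continuous_ofReal.comp_continuousOn
      (h.norm.rpow_const fun x _ => Or.inr (by linarith))
  have hFi : ∀ j R, IntegrableOn (F j) (Ioc 0 R) := fun j R =>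
    (((hFc j).mono (Icc_subset_Ici_self : Icc 0 R ⊆ Ici 0)).integrableOn_Icc).mono_set
      Ioc_subset_Icc_self
  have hgF : ∀ j, IsWeakDeriv (g j) (F j) := fun j η h1 h2 h3 => by
    rw [hv.euler_lagrange_edge hp hg h1 h2 j,
      image_eq_zero_of_notMem_tsupport (fun h => lt_irrefl (0 : ℝ) (h3 h) : (0 : ℝ) ∉ tsupport η)]
    simp [hF]
  have hgi := fun j => integrableOn_Ioc_of_memLp (hg j).1
  choose c hc using fun j => (hgF j).exists_ae_eq (hgi j) (hFi j)
  set G : Fin N → ℝ → ℂ := fun j x => c j + ∫ t in (0 : ℝ)..x, F j t with hG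
  have hGL : ∀ j, MemLp (G j) 2 (volume.restrict (Ioi 0)) := fun j => (hg j).1.ae_eq (hc j)
  have hGw : ∀ j, IsL2WeakDeriv (v j) (G j) := fun j => by
    refine ⟨hGL j, fun η h1 h2 h3 => ?_⟩
    rw [(hg j).2 η h1 h2 h3]
    congr 1
    refine integral_congr_ae ?_
    filter_upwards [hc j] with x hx
    rw [hx]
  have hGc : ∀ j, ContinuousOn (G j) (Ici 0) := fun j =>
    continuousOn_const.add (continuousOn_integral (hFc j))
  refine ⟨G, fun j => ⟨⟨hv.1.1 j, hGc j, fun x hx => ?_, fun x hx => ?_,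
    hGL j⟩, ?_⟩⟩
  · have h1 := (hasDerivAt_integral_of_continuousOn (hGc j) hx).const_add (v j 0)
    refine h1.congr_of_eventuallyEq ?_
    filter_upwards [lt_mem_nhds hx] with y hy
    exact (hv.1.1 j).eq_add_integral (hGw j) hy.le
  · exact (hasDerivAt_integral_of_continuousOn (hFc j) hx).const_add (c j)
  · have hG0 : G j 0 = c j := by simp [hG]
    rw [hG0]
    -- test with a function equal to `1` at the vertex
    let b : ContDiffBump (0 : ℝ) := ⟨1, 2, by norm_num, by norm_num⟩
    have hb1 : ContDiff ℝ (⊤ : ℕ∞) (b : ℝ → ℝ) := b.contDiff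
    have hb2 : HasCompactSupport (b : ℝ → ℝ) := b.hasCompactSupport
    have hb0 : b 0 = 1 := b.one_of_mem_closedBall (by simp [b])
    have hcd : Continuous (deriv b) := hb1.continuous_deriv (by simp)
    have hη' := memLp_of_hasCompactSupport hcd hb2.deriv
    have hel := hv.euler_lagrange_edge hp hGw hb1 hb2 j
    have hip := integral_deriv_test_mul_primitive (hFi j) hb1 hb2
    have i1 : Integrable (fun x => ((deriv b x : ℝ) : ℂ)) (volume.restrict (Ioi 0)) :=
      ((Complex.continuous_ofReal.comp hcd).integrable_of_hasCompactSupport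
        (hb2.deriv.comp_left (g := Complex.ofReal) (by simp))).integrableOn
    have i2 := integrable_mul_of_memLp hη' (hGL j)
    have e1 : ∫ x in Ioi (0 : ℝ), ((deriv b x : ℝ) : ℂ) = -1 := by
      rw [integral_complex_ofReal, hb2.integral_Ioi_deriv_eq (hb1.of_le (by simp)), hb0]; simp
    have e2 : ∫ x in Ioi (0 : ℝ), ((deriv b x : ℝ) : ℂ) * ∫ t in (0 : ℝ)..x, F j t
        = (∫ x in Ioi (0 : ℝ), ((deriv b x : ℝ) : ℂ) * G j x) + c j := by
      have : ∀ x, ((deriv b x : ℝ) : ℂ) * ∫ t in (0 : ℝ)..x, F j t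
          = ((deriv b x : ℝ) : ℂ) * G j x - ((deriv b x : ℝ) : ℂ) * c j := fun x => by
        simp only [hG]; ring
      simp_rw [this]
      rw [integral_sub i2 (i1.mul_const _), integral_mul_const, e1]
      ring
    rw [e2, hel, hb0] at hip
    push_cast at hip ⊢
    linear_combination hip

/-! ### Classification of the solutions on an edge -/

theorem eq_of_hasDerivAt_zero {E : Type*} [NormedAddCommGroup E] [NormedSpace ℝ E] {f : ℝ → E}
    (hf : ContinuousOn f (Ici 0)) (hd : ∀ x, 0 < x → HasDerivAt f 0 x) {x : ℝ} (hx : 0 ≤ x) :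
    f x = f 0 := by
  rcases hx.eq_or_lt with rfl | hx
  · rfl
  have h1 : ∀ᶠ y in 𝓝[>] (0 : ℝ), f y = f x := by
    filter_upwards [Ioo_mem_nhdsGT hx] with y hy
    exact (constant_of_has_deriv_right_zero (hf.mono fun t ht => hy.1.le.trans ht.1)
      (fun t ht => (hd t (hy.1.trans_le ht.1)).hasDerivWithinAt) x ⟨hy.2.le, le_rfl⟩).symm
  have h2 : Tendsto f (𝓝[>] 0) (𝓝 (f 0)) :=
    (hf 0 self_mem_Ici).mono_left (nhdsWithin_mono _ Ioi_subset_Ici_self)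
  exact tendsto_nhds_unique ((tendsto_congr' h1).2 tendsto_const_nhds) h2

theorem eq_zero_of_integrableOn_Ioi {f : ℝ → ℝ} (hf : IntegrableOn f (Ioi 0))
    (hc : ∀ x, 0 ≤ x → f x = f 0) : f 0 = 0 := by
  have h : IntegrableOn (fun _ : ℝ => f 0) (Ioi 0) :=
    hf.congr_fun (fun x hx => hc x (le_of_lt hx)) measurableSet_Ioi
  rw [integrableOn_const_iff] at h
  simpa using h

namespace IsEdgeSolution

variable {p ω : ℝ} {v G : ℝ → ℂ}

theorem cont (h : IsEdgeSolution p ω v G) : ContinuousOn v (Ici 0) := h.memH1.continuousOn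

theorem hasDerivAt_norm_sq (h : IsEdgeSolution p ω v G) {x : ℝ} (hx : 0 < x) :
    HasDerivAt (fun x => ‖v x‖ ^ 2) (2 * inner ℝ (v x) (G x)) x :=
  (h.deriv x hx).norm_sq

/-- Conservation of energy. The constant vanishes since the energy is integrable. -/
theorem energy (hp : 1 < p) (h : IsEdgeSolution p ω v G) {x : ℝ} (hx : 0 ≤ x) :
    ‖G x‖ ^ 2 = ω * ‖v x‖ ^ 2 - 2 / (p + 1) * ‖v x‖ ^ (p + 1) := by
  set E : ℝ → ℝ := fun x => ‖G x‖ ^ 2 - ω * ‖v x‖ ^ 2 + 2 / (p + 1) * ‖v x‖ ^ (p + 1) with hE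
  have hc : ∀ x, 0 ≤ x → E x = E 0 := fun x hx => by
    refine eq_of_hasDerivAt_zero ?_ (fun y hy => ?_) hx
    · refine ((h.cont'.norm.pow 2).sub (continuousOn_const.mul (h.cont.norm.pow 2))).add
        (continuousOn_const.mul (h.cont.norm.rpow_const fun x _ => Or.inr (by linarith)))
    · have d1 := (h.deriv' y hy).norm_sq
      have d2 := h.hasDerivAt_norm_sq hy
      have d3 := d2.rpow_const (p := (p + 1) / 2) (Or.inr (by linarith))
      have e : ∀ (z : ℂ) (r : ℝ), (‖z‖ ^ 2) ^ (r / 2) = ‖z‖ ^ r := fun z r => by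
        rw [← Real.rpow_two, ← Real.rpow_mul (norm_nonneg _)]; congr 1; ring
      simp only [e] at d3
      rw [show (p + 1) / 2 - 1 = (p - 1) / 2 by ring, e] at d3
      refine ((d1.fun_sub (d2.const_mul ω)).fun_add (d3.const_mul (2 / (p + 1)))).congr_deriv ?_
      rw [inner_sub_right, ← Complex.real_smul, ← Complex.real_smul, inner_smul_right,
        inner_smul_right, real_inner_comm (v y)]
      have : p + 1 ≠ 0 := by linarith
      field_simp
      ring
  have hi : IntegrableOn E (Ioi 0) :=
    ((integrable_norm_sq h.memLp').sub ((integrable_norm_sq h.memH1.memLp).const_mul ω)).add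
      ((h.memH1.integrable_rpow (by linarith : 2 ≤ p + 1)).const_mul (2 / (p + 1)))
  have := (hc x hx).trans (eq_zero_of_integrableOn_Ioi hi hc)
  simp only [hE] at this
  linarith

/-- Conservation of angular momentum: `conj v * v'` is real. -/
theorem im_conj_mul_eq_zero (h : IsEdgeSolution p ω v G) {x : ℝ} (hx : 0 ≤ x) :
    (starRingEnd ℂ (v x) * G x).im = 0 := by
  set E : ℝ → ℝ := fun x => (starRingEnd ℂ (v x) * G x).im with hE
  have hEi : ∀ x, E x = inner ℝ (Complex.I * v x) (G x) := fun x => by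
    simp [hE, Complex.inner]; ring
  have hc : ∀ x, 0 ≤ x → E x = E 0 := fun x hx => by
    refine eq_of_hasDerivAt_zero ?_ (fun y hy => ?_) hx
    · exact Complex.continuous_im.comp_continuousOn
        ((Complex.continuous_conj.comp_continuousOn h.cont).mul h.cont')
    · have d := ((h.deriv y hy).const_mul Complex.I).inner ℝ (h.deriv' y hy)
      rw [show E = fun x => inner ℝ (Complex.I * v x) (G x) from funext hEi]
      refine d.congr_deriv ?_
      simp [Complex.inner]; ring
  have hi : IntegrableOn E (Ioi 0) := by
    rw [show E = fun x => inner ℝ (Complex.I * v x) (G x) from funext hEi]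
    exact integrable_inner_of_memLp (h.memH1.memLp.const_mul _) h.memLp'
  exact (hc x hx).trans (eq_zero_of_integrableOn_Ioi hi hc)

theorem norm_deriv_le (hp : 1 < p) (hω : 0 < ω) (h : IsEdgeSolution p ω v G) {x : ℝ}
    (hx : 0 ≤ x) : ‖G x‖ ≤ √ω * ‖v x‖ := by
  refine abs_le_of_sq_le_sq' ?_ (by positivity) |>.2
  rw [h.energy hp hx, mul_pow, Real.sq_sqrt hω.le]
  have : 0 ≤ 2 / (p + 1) * ‖v x‖ ^ (p + 1) := by positivity
  linarith

theorem abs_inner_le (hp : 1 < p) (hω : 0 < ω) (h : IsEdgeSolution p ω v G) {x : ℝ}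
    (hx : 0 ≤ x) : |inner ℝ (v x) (G x)| ≤ √ω * ‖v x‖ ^ 2 := by
  refine (abs_real_inner_le_norm _ _).trans ?_
  have := mul_le_mul_of_nonneg_left (h.norm_deriv_le hp hω hx) (norm_nonneg (v x))
  linarith

/-- A solution with a zero vanishes identically, because `|v'| ≤ √ω |v|`. -/
theorem eq_zero_of_eq_zero (hp : 1 < p) (hω : 0 < ω) (h : IsEdgeSolution p ω v G) {x₀ : ℝ}
    (hx₀ : 0 ≤ x₀) (h0 : v x₀ = 0) {x : ℝ} (hx : 0 ≤ x) : v x = 0 := by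
  have hce : ∀ c : ℝ, ContinuousOn (fun x => ‖v x‖ ^ 2 * Real.exp (c * x)) (Ici 0) := fun c =>
    (h.cont.norm.pow 2).mul (by fun_prop)
  have hde : ∀ c y : ℝ, 0 < y → HasDerivAt (fun x => ‖v x‖ ^ 2 * Real.exp (c * x))
      ((2 * inner ℝ (v y) (G y) + c * ‖v y‖ ^ 2) * Real.exp (c * y)) y := fun c y hy => by
    have d1 : HasDerivAt (fun x : ℝ => Real.exp (c * x)) (Real.exp (c * y) * (c * 1)) y :=
      ((hasDerivAt_id y).const_mul c).exp
    exact ((h.hasDerivAt_norm_sq hy).fun_mul d1).congr_deriv (by ring)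
  have key : ∀ c y : ℝ, ‖v y‖ ^ 2 * Real.exp (c * y) ≤ 0 → v y = 0 := fun c y hy => by
    have h1 : ‖v y‖ ^ 2 ≤ 0 := by
      by_contra hcon
      exact absurd hy (not_le.2 (mul_pos (not_le.1 hcon) (Real.exp_pos _)))
    exact norm_eq_zero.1 (pow_eq_zero_iff two_ne_zero |>.1 (le_antisymm h1 (sq_nonneg _)))
  rcases le_total x x₀ with hxx | hxx
  · have hmono : MonotoneOn (fun x => ‖v x‖ ^ 2 * Real.exp ((2 * √ω) * x)) (Ici 0) := by
      refine monotoneOn_of_deriv_nonneg (convex_Ici 0) (hce _) ?_ ?_ <;> rw [interior_Ici]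
      · exact fun y hy => (hde _ y hy).differentiableAt.differentiableWithinAt
      · intro y hy
        rw [(hde _ y hy).deriv]
        have := neg_le_of_abs_le (h.abs_inner_le hp hω (le_of_lt hy))
        exact mul_nonneg (by linarith) (Real.exp_pos _).le
    refine key (2 * √ω) x ((hmono hx hx₀ hxx).trans (by simp [h0]))
  · have hanti : AntitoneOn (fun x => ‖v x‖ ^ 2 * Real.exp ((-(2 * √ω)) * x)) (Ici 0) := by
      refine antitoneOn_of_deriv_nonpos (convex_Ici 0) (hce _) ?_ ?_ <;> rw [interior_Ici]
      · exact fun y hy => (hde _ y hy).differentiableAt.differentiableWithinAt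
      · intro y hy
        rw [(hde _ y hy).deriv]
        have := le_of_abs_le (h.abs_inner_le hp hω (le_of_lt hy))
        exact mul_nonpos_of_nonpos_of_nonneg (by linarith) (Real.exp_pos _).le
    refine key (-(2 * √ω)) x ((hanti hx₀ hx hxx).trans (by simp [h0]))

theorem ne_zero (hp : 1 < p) (hω : 0 < ω) (h : IsEdgeSolution p ω v G) (h0 : v 0 ≠ 0) {x : ℝ}
    (hx : 0 ≤ x) : v x ≠ 0 := fun hx0 => h0 (h.eq_zero_of_eq_zero hp hω hx hx0 le_rfl)

theorem sq_norm_mul_deriv (h : IsEdgeSolution p ω v G) {x : ℝ} (hx : 0 ≤ x) :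
    (‖v x‖ ^ 2 : ℂ) * G x = (inner ℝ (v x) (G x) : ℝ) * v x := by
  have h1 : starRingEnd ℂ (v x) * G x = (inner ℝ (v x) (G x) : ℝ) := by
    apply Complex.ext
    · simp [Complex.inner]; ring
    · rw [h.im_conj_mul_eq_zero hx, Complex.ofReal_im]
  rw [← h1, ← Complex.mul_conj']
  ring

/-- The phase of a solution is constant. -/
theorem div_norm_eq (hp : 1 < p) (hω : 0 < ω) (h : IsEdgeSolution p ω v G) (h0 : v 0 ≠ 0) {x : ℝ}
    (hx : 0 ≤ x) : v x / ‖v x‖ = v 0 / ‖v 0‖ := by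
  refine eq_of_hasDerivAt_zero (f := fun x => v x / (‖v x‖ : ℂ)) ?_ (fun y hy => ?_) hx
  · refine h.cont.div (Complex.continuous_ofReal.comp_continuousOn h.cont.norm) fun y hy => ?_
    exact_mod_cast norm_ne_zero_iff.2 (h.ne_zero hp hω h0 hy)
  · have hne := norm_ne_zero_iff.2 (h.ne_zero hp hω h0 hy.le)
    have d1 := (h.hasDerivAt_norm_sq hy).sqrt (by positivity)
    simp only [Real.sqrt_sq (norm_nonneg _)] at d1
    have hne' : (‖v y‖ : ℂ) ≠ 0 := by exact_mod_cast hne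
    refine ((h.deriv y hy).fun_div d1.ofReal_comp hne').congr_deriv ?_
    rw [div_eq_zero_iff]
    left
    have := h.sq_norm_mul_deriv hy.le
    push_cast
    field_simp
    linear_combination this

end IsEdgeSolution

/-- The derivative of the shifted soliton. -/
def solitonDeriv (p ω a x : ℝ) : ℝ :=
  -(√ω * Real.tanh ((p - 1) * √ω / 2 * (x + a)) * soliton p ω a x)

theorem soliton_pos {p ω : ℝ} (hp : 1 < p) (hω : 0 < ω) (a x : ℝ) : 0 < soliton p ω a x := by
  have := Real.cosh_pos ((p - 1) * √ω / 2 * (x + a))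
  unfold soliton
  positivity

/-- The soliton in terms of `tanh`, through `sech² = 1 - tanh²`. -/
theorem soliton_rpow {p ω : ℝ} (hp : 1 < p) (hω : 0 < ω) (a x : ℝ) :
    soliton p ω a x ^ (p - 1) =
      (p + 1) * ω / 2 * (1 - Real.tanh ((p - 1) * √ω / 2 * (x + a)) ^ 2) := by
  have hc := Real.cosh_pos ((p - 1) * √ω / 2 * (x + a))
  rw [soliton, ← Real.rpow_mul (by positivity), one_div_mul_cancel (by linarith), Real.rpow_one,
    Real.tanh_eq_sinh_div_cosh]
  field_simp
  have := Real.cosh_sq ((p - 1) * √ω / 2 * (x + a))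
  ring_nf at this ⊢
  linarith

theorem hasDerivAt_soliton {p ω : ℝ} (hp : 1 < p) (hω : 0 < ω) (a x : ℝ) :
    HasDerivAt (soliton p ω a) (solitonDeriv p ω a x) x := by
  set k := (p - 1) * √ω / 2 with hk
  have hc := Real.cosh_pos (k * (x + a))
  have d0 : HasDerivAt (fun y : ℝ => k * (y + a)) k x := by
    simpa using ((hasDerivAt_id x).add_const a).const_mul k
  have d1 := ((d0.cosh.fun_inv hc.ne').fun_pow 2).const_mul ((p + 1) * ω / 2)
  have hpos : 0 < (p + 1) * ω / 2 * (Real.cosh (k * (x + a)))⁻¹ ^ 2 := by positivity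
  have d2 := d1.rpow_const (p := 1 / (p - 1)) (Or.inl hpos.ne')
  have e : soliton p ω a =
      fun y => ((p + 1) * ω / 2 * (Real.cosh (k * (y + a)))⁻¹ ^ 2) ^ (1 / (p - 1)) := by
    funext y; simp [soliton, hk]
  rw [e]
  refine d2.congr_deriv ?_
  rw [solitonDeriv, e, Real.rpow_sub_one hpos.ne', Real.tanh_eq_sinh_div_cosh]
  have hp1 : p - 1 ≠ 0 := by linarith
  have hp2 : p + 1 ≠ 0 := by linarith
  simp only [← hk]
  generalize ((p + 1) * ω / 2 * (Real.cosh (k * (x + a)))⁻¹ ^ 2) ^ (1 / (p - 1)) = Z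
  rw [show √ω = 2 * k / (p - 1) by rw [hk]; field_simp]
  push_cast
  field_simp

theorem continuous_soliton {p ω : ℝ} (hp : 1 < p) (hω : 0 < ω) (a : ℝ) :
    Continuous (soliton p ω a) :=
  continuous_iff_continuousAt.2 fun x => (hasDerivAt_soliton hp hω a x).continuousAt

theorem hasDerivAt_tanh (x : ℝ) : HasDerivAt Real.tanh (1 - Real.tanh x ^ 2) x := by
  have hc := Real.cosh_pos x
  have d := (Real.hasDerivAt_sinh x).fun_div (Real.hasDerivAt_cosh x) hc.ne'
  rw [show Real.tanh = fun x => Real.sinh x / Real.cosh x from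
    funext Real.tanh_eq_sinh_div_cosh]
  refine d.congr_deriv ?_
  field_simp

theorem hasDerivAt_solitonDeriv {p ω : ℝ} (hp : 1 < p) (hω : 0 < ω) (a x : ℝ) :
    HasDerivAt (solitonDeriv p ω a) (ω * soliton p ω a x - soliton p ω a x ^ p) x := by
  set k := (p - 1) * √ω / 2 with hk
  have d0 : HasDerivAt (fun y : ℝ => k * (y + a)) k x := by
    simpa using ((hasDerivAt_id x).add_const a).const_mul k
  have d1 := (((hasDerivAt_tanh (k * (x + a))).comp x d0).const_mul (√ω)).fun_mul
    (hasDerivAt_soliton hp hω a x)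
  refine d1.fun_neg.congr_deriv ?_
  have h1 : soliton p ω a x ^ p = soliton p ω a x ^ (p - 1) * soliton p ω a x := by
    rw [← Real.rpow_add_one (soliton_pos hp hω a x).ne']; congr 1; ring
  rw [h1, soliton_rpow hp hω, solitonDeriv]
  simp only [← hk, Function.comp]
  have hs := Real.sq_sqrt hω.le
  rw [hk]
  linear_combination ((Real.tanh ((p - 1) * √ω / 2 * (x + a)) ^ 2
    - (p - 1) / 2 * (1 - Real.tanh ((p - 1) * √ω / 2 * (x + a)) ^ 2)) * soliton p ω a x) * hs

/-- Real positive solutions of the stationary equation with zero energy are shifted solitons: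
the substitution `w = U ^ (-(p - 1) / 2)` turns the equation into the linear `w'' = k² w`. -/
theorem exists_eq_soliton_of_ode {p ω : ℝ} (hp : 1 < p) (hω : 0 < ω) {U g : ℝ → ℝ}
    (hU : ContinuousOn U (Ici 0)) (hg : ContinuousOn g (Ici 0)) (hpos : ∀ x, 0 ≤ x → 0 < U x)
    (d1 : ∀ x, 0 < x → HasDerivAt U (g x) x)
    (d2 : ∀ x, 0 < x → HasDerivAt g (ω * U x - U x ^ p) x)
    (he : ∀ x, 0 ≤ x → g x ^ 2 = ω * U x ^ 2 - 2 / (p + 1) * U x ^ (p + 1)) :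
    ∃ a : ℝ, ∀ x, 0 ≤ x → U x = soliton p ω a x := by
  set q := (p - 1) / 2 with hq
  have hq0 : 0 < q := by rw [hq]; linarith
  set k := q * √ω with hk
  have hk0 : 0 < k := by positivity
  have hk2 : k ^ 2 = q ^ 2 * ω := by rw [hk, mul_pow, Real.sq_sqrt hω.le]
  have hp1 : p + 1 = 2 * (q + 1) := by rw [hq]; ring
  set w : ℝ → ℝ := fun x => U x ^ (-q) with hw
  set W : ℝ → ℝ := fun x => -q * U x ^ (-q - 1) * g x with hW
  have r1 : ∀ x, 0 ≤ x → U x ^ (-q - 1) = w x / U x := fun x hx =>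
    Real.rpow_sub_one (hpos x hx).ne' _
  have r2 : ∀ x, 0 ≤ x → U x ^ (-q - 1 - 1) = w x / U x / U x := fun x hx => by
    rw [Real.rpow_sub_one (hpos x hx).ne', r1 x hx]
  have r3 : ∀ x, 0 ≤ x → U x ^ p = U x * U x ^ (p - 1) := fun x hx => by
    rw [← Real.rpow_one_add' (hpos x hx).le (by linarith)]; congr 1; ring
  have r4 : ∀ x, 0 ≤ x → U x ^ (p + 1) = U x ^ 2 * U x ^ (p - 1) := fun x hx => by
    rw [← Real.rpow_two, ← Real.rpow_add (hpos x hx)]; congr 1; ring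
  have r5 : ∀ x, 0 ≤ x → w x ^ 2 * U x ^ (p - 1) = 1 := fun x hx => by
    rw [hw, ← Real.rpow_two, ← Real.rpow_mul (hpos x hx).le, ← Real.rpow_add (hpos x hx)]
    rw [show -q * 2 + (p - 1) = 0 by rw [hq]; ring, Real.rpow_zero]
  have hwc : ContinuousOn w (Ici 0) := hU.rpow_const fun x hx => Or.inl (hpos x hx).ne'
  have hWc : ContinuousOn W (Ici 0) :=
    (continuousOn_const.mul (hU.rpow_const fun x hx => Or.inl (hpos x hx).ne')).mul hg
  have dw : ∀ x, 0 < x → HasDerivAt w (W x) x := fun x hx =>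
    ((d1 x hx).rpow_const (p := -q) (Or.inl (hpos x hx.le).ne')).congr_deriv (by
      simp only [hW]; ring)
  have dW : ∀ x, 0 < x → HasDerivAt W (k ^ 2 * w x) x := fun x hx => by
    have hU0 := (hpos x hx.le).ne'
    refine ((((d1 x hx).rpow_const (p := -q - 1) (Or.inl hU0)).const_mul (-q)).fun_mul
      (d2 x hx)).congr_deriv ?_
    have e1 : -q * (g x * (-q - 1) * U x ^ (-q - 1 - 1)) * g x
      = q * (q + 1) * U x ^ (-q - 1 - 1) * g x ^ 2 := by ring
    rw [e1, he x hx.le, r2 x hx.le, r1 x hx.le, r3 x hx.le, r4 x hx.le, hk2, hp1]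
    have : q + 1 ≠ 0 := by linarith
    field_simp
    ring
  -- the linear equation is solved by two first integrals
  have hexp : ∀ c : ℝ, ∀ x, HasDerivAt (fun x : ℝ => Real.exp (c * x)) (Real.exp (c * x) * c) x :=
    fun c x => by simpa using ((hasDerivAt_id x).const_mul c).exp
  have hA : ∀ c : ℝ, c ^ 2 = k ^ 2 → ∀ x, 0 ≤ x →
      (W x + c * w x) * Real.exp (-c * x) = W 0 + c * w 0 := fun c hc x hx => by
    have := eq_of_hasDerivAt_zero (f := fun x => (W x + c * w x) * Real.exp (-c * x))
      ((hWc.add (continuousOn_const.mul hwc)).mul (by fun_prop)) (fun y hy => by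
        refine (((dW y hy).fun_add ((dw y hy).const_mul c)).fun_mul (hexp (-c) y)).congr_deriv ?_
        rw [← hc]; ring) hx
    simpa using this
  have hlin : ∀ x, 0 ≤ x → k * w x = k * w 0 * Real.cosh (k * x) + W 0 * Real.sinh (k * x) :=
    fun x hx => by
    have a1 := hA k rfl x hx
    have a2 := hA (-k) (by ring) x hx
    rw [neg_neg] at a2
    have a3 : Real.exp (k * x) * Real.exp (-k * x) = 1 := by
      rw [← Real.exp_add]; simp
    rw [Real.cosh_eq, Real.sinh_eq, show -(k * x) = -k * x by ring]
    linear_combination (Real.exp (k * x) / 2) * a1 - (Real.exp (-k * x) / 2) * a2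
      - (k * w x) * a3
  -- `(k w)² - (w')²` is constant, by the energy identity; `c²` is its value
  set c := q * √(2 / (p + 1)) with hcdef
  have hc0 : 0 < c := by positivity
  have hc2 : c ^ 2 = q ^ 2 * (2 / (p + 1)) := by
    rw [hcdef, mul_pow, Real.sq_sqrt (by positivity)]
  have hinv : (k * w 0) ^ 2 - W 0 ^ 2 = c ^ 2 := by
    have e := r5 0 le_rfl
    have hU0 := (hpos 0 le_rfl).ne'
    have e1 : W 0 ^ 2 = q ^ 2 * (U 0 ^ (-q - 1)) ^ 2 * g 0 ^ 2 := by simp only [hW]; ring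
    rw [e1, he 0 le_rfl, r1 0 le_rfl, r4 0 le_rfl, hc2, mul_pow, hk2]
    field_simp
    linear_combination 2 * e
  have hw0 : 0 < w 0 := Real.rpow_pos_of_pos (hpos 0 le_rfl) _
  refine ⟨Real.arsinh (W 0 / c) / k, fun x hx => ?_⟩
  have hs : c * Real.sinh (Real.arsinh (W 0 / c)) = W 0 := by
    rw [Real.sinh_arsinh]; field_simp
  have hch : c * Real.cosh (Real.arsinh (W 0 / c)) = k * w 0 := by
    have h1 := Real.cosh_sq (Real.arsinh (W 0 / c))
    refine (pow_left_inj₀ (by have := Real.cosh_pos (Real.arsinh (W 0 / c)); positivity)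
      (by positivity) two_ne_zero).1 ?_
    rw [mul_pow, h1, mul_add, ← mul_pow, hs]
    linarith
  have hfin : k * w x = c * Real.cosh (k * (x + Real.arsinh (W 0 / c) / k)) := by
    rw [hlin x hx, show k * (x + Real.arsinh (W 0 / c) / k) = k * x + Real.arsinh (W 0 / c) by
      field_simp, Real.cosh_add]
    linear_combination (-Real.cosh (k * x)) * hch - Real.sinh (k * x) * hs
  have hkk : (p - 1) * √ω / 2 = k := by rw [hk, hq]; ring
  have hwx : 0 < w x := Real.rpow_pos_of_pos (hpos x hx) _
  rw [soliton, hkk]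
  have hcosh : Real.cosh (k * (x + Real.arsinh (W 0 / c) / k)) = k * w x / c := by
    rw [hfin]; field_simp
  rw [hcosh]
  have e1 : (p + 1) * ω / 2 * (1 / (k * w x / c)) ^ 2 = U x ^ (p - 1) := by
    have e := r5 x hx
    have hppos : p + 1 ≠ 0 := by linarith
    have : (1 / (k * w x / c)) ^ 2 = c ^ 2 / (k ^ 2 * w x ^ 2) := by field_simp
    rw [this, hc2, hk2, eq_comm, ← mul_right_inj' (pow_pos hwx 2).ne', e]
    field_simp
  rw [e1, ← Real.rpow_mul (hpos x hx).le, mul_one_div_cancel (by linarith), Real.rpow_one]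

/-- Classification of the nontrivial solutions on an edge. -/
theorem IsEdgeSolution.exists_eq_soliton {p ω : ℝ} {v G : ℝ → ℂ} (hp : 1 < p) (hω : 0 < ω)
    (h : IsEdgeSolution p ω v G) (h0 : v 0 ≠ 0) :
    ∃ a : ℝ, ∀ x, 0 ≤ x → v x = v 0 / ‖v 0‖ * (soliton p ω a x : ℝ) ∧
      G x = v 0 / ‖v 0‖ * (solitonDeriv p ω a x : ℝ) := by
  set e := v 0 / ‖v 0‖ with he
  have hn : ∀ x, 0 ≤ x → 0 < ‖v x‖ := fun x hx => norm_pos_iff.2 (h.ne_zero hp hω h0 hx)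
  have hen : ‖e‖ = 1 := by
    rw [he, norm_div, Complex.norm_real, norm_norm, div_self (hn 0 le_rfl).ne']
  have hv : ∀ x, 0 ≤ x → v x = e * ‖v x‖ := fun x hx => by
    have hne : (‖v x‖ : ℂ) ≠ 0 := by exact_mod_cast (hn x hx).ne'
    rw [he, ← h.div_norm_eq hp hω h0 hx]
    field_simp
  have hee : ∀ r : ℝ, inner ℝ e (e * (r : ℂ)) = r := fun r => by
    rw [mul_comm, ← Complex.real_smul, inner_smul_right, real_inner_self_eq_norm_sq, hen]; ring
  have hG : ∀ x, 0 ≤ x → G x = e * (inner ℝ e (G x) : ℝ) := fun x hx => by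
    have hne : (‖v x‖ : ℂ) ≠ 0 := by exact_mod_cast (hn x hx).ne'
    have h1 : G x = e * ((inner ℝ (v x) (G x) / ‖v x‖ : ℝ) : ℂ) := by
      have h2 := h.sq_norm_mul_deriv hx
      have h3 := hv x hx
      push_cast
      rw [mul_div_assoc', eq_div_iff hne]
      refine mul_left_cancel₀ hne ?_
      linear_combination h2 + (inner ℝ (v x) (G x) : ℂ) * h3
    conv_lhs => rw [h1]
    conv_rhs => rw [h1]
    rw [hee]
  -- `inner ℝ e (v x)` is the modulus of `v x`, and `g` is its derivative
  set g : ℝ → ℝ := fun x => inner ℝ e (G x) with hg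
  have hU : ∀ x, 0 ≤ x → ‖v x‖ = inner ℝ e (v x) := fun x hx => by
    conv_rhs => rw [hv x hx]
    rw [hee]
  have hgn : ∀ x, 0 ≤ x → g x ^ 2 = ‖G x‖ ^ 2 := fun x hx => by
    rw [hG x hx, norm_mul, hen, one_mul, Complex.norm_real, Real.norm_eq_abs, sq_abs]
  obtain ⟨a, ha⟩ := exists_eq_soliton_of_ode hp hω (U := fun x => inner ℝ e (v x)) (g := g)
    (continuousOn_const.inner h.cont) (continuousOn_const.inner h.cont')
    (fun x hx => by rw [← hU x hx]; exact hn x hx)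
    (fun x hx => by simpa [hg] using (hasDerivAt_const x e).inner ℝ (h.deriv x hx))
    (fun x hx => by
      have d := (hasDerivAt_const x e).inner ℝ (h.deriv' x hx)
      refine d.congr_deriv ?_
      rw [inner_zero_left, add_zero, inner_sub_right, ← Complex.real_smul, ← Complex.real_smul,
        inner_smul_right, inner_smul_right, ← hU x hx.le, ← Real.rpow_add_one (hn x hx.le).ne']
      congr 2; ring)
    (fun x hx => by rw [← hU x hx, hgn x hx, h.energy hp hx])
  have hgs : EqOn g (solitonDeriv p ω a) (Ici 0) := by
    have hcs : Continuous (solitonDeriv p ω a) :=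
      continuous_iff_continuousAt.2 fun x => (hasDerivAt_solitonDeriv hp hω a x).continuousAt
    refine EqOn.of_subset_closure (s := Ioi 0) (fun x hx => ?_)
      (continuousOn_const.inner h.cont') hcs.continuousOn Ioi_subset_Ici_self
      (by rw [closure_Ioi])
    have d1 : HasDerivAt (fun x => inner ℝ e (v x)) (g x) x := by
      simpa [hg] using (hasDerivAt_const x e).inner ℝ (h.deriv x hx)
    refine d1.unique ((hasDerivAt_soliton hp hω a x).congr_of_eventuallyEq ?_)
    filter_upwards [lt_mem_nhds hx] with y hy using ha y hy.le
  refine ⟨a, fun x hx => ⟨?_, ?_⟩⟩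
  · rw [← ha x hx, ← hU x hx]; exact hv x hx
  · rw [← hgs hx]; exact hG x hx

/-! ### Phases and coupling at the vertex -/

/-- A minimizer has the least quadratic part among functions with the same `L^(p+1)` norm. -/
theorem IsNehariMinimizer.linForm_le {p β ω : ℝ} (hp : 1 < p) {v w : Fin N → ℝ → ℂ}
    (hv : IsNehariMinimizer p β ω v) (hw : MemH1 w)
    (hP : lpNormPow (p + 1) w = lpNormPow (p + 1) v) (hpos : 0 < linForm β ω w) :
    linForm β ω v ≤ linForm β ω w := by
  have hM := hv.lpNormPow_pos hp
  have h := hv.le_linForm hp hw hpos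
  rw [hP, ← Real.rpow_two, ← Real.rpow_add hM, show p - 1 + 2 = p + 1 by ring] at h
  rw [hv.linForm_eq_lpNormPow]
  exact (Real.rpow_le_rpow_iff hM.le hpos.le (by linarith)).1 h

theorem lpNormPow_phase (q : ℝ) (v : Fin N → ℝ → ℂ) {c : Fin N → ℂ} (hc : ∀ j, ‖c j‖ = 1) :
    lpNormPow q (fun j x => c j * v j x) = lpNormPow q v := by
  simp [lpNormPow, hc]

theorem linForm_phase {β ω : ℝ} {v : Fin N → ℝ → ℂ} (hv : MemH1 v) {c : Fin N → ℂ}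
    (hc : ∀ j, ‖c j‖ = 1) : linForm β ω (fun j x => c j * v j x) =
      linForm β ω v + 1 / β * (‖∑ j, c j * v j 0‖ ^ 2 - ‖∑ j, v j 0‖ ^ 2) := by
  have hg := fun j => isL2WeakDeriv_weakDeriv (hv j).exists_weakDeriv
  rw [linForm_eq hg, linForm_eq fun j => (hg j).const_mul (c j)]
  simp only [norm_mul, hc, one_mul]
  ring

/-- Rotating the phase on the `j`-th edge changes only the coupling term of the action. Since
`β < 0`, minimality forces the value at the vertex on this edge to be aligned with the sum of the
others. -/
theorem IsNehariMinimizer.inner_sub_nonneg {p β ω : ℝ} (hp : 1 < p) (hβ : β < 0)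
    {v : Fin N → ℝ → ℂ} (hv : IsNehariMinimizer p β ω v) (j : Fin N) :
    0 ≤ inner ℝ (∑ i, v i 0 - v j 0) (v j 0) := by
  set M := lpNormPow (p + 1) v
  have hM : 0 < M := hv.lpNormPow_pos hp
  set z := v j 0
  set R := ∑ i, v i 0 - z with hR
  set δ : ℝ → ℝ := fun τ => ‖R + Complex.exp (τ * Complex.I) * z‖ ^ 2 - ‖R + z‖ ^ 2 with hδ
  have hδe : ∀ τ, δ τ = 2 * ((Real.cos τ - 1) * inner ℝ R z
      + Real.sin τ * inner ℝ R (Complex.I * z)) := fun τ => by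
    have e : Complex.exp (τ * Complex.I) * z
        = Real.cos τ • z + Real.sin τ • (Complex.I * z) := by
      rw [Complex.exp_mul_I, Complex.real_smul, Complex.real_smul]; push_cast; ring
    have hn : ‖Complex.exp (τ * Complex.I) * z‖ = ‖z‖ := by
      rw [norm_mul, Complex.norm_exp_ofReal_mul_I, one_mul]
    simp only [hδ]
    rw [norm_add_sq_real, hn, norm_add_sq_real, e, inner_add_right, inner_smul_right,
      inner_smul_right]
    ring
  have hcont : Tendsto (fun τ => M + 1 / β * δ τ) (𝓝 0) (𝓝 M) := by
    have hc : Continuous fun τ => M + 1 / β * δ τ := by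
      rw [show δ = _ from funext hδe]; fun_prop
    have := hc.tendsto 0
    simpa [hδe] using this
  have hev : ∀ᶠ τ in 𝓝 (0 : ℝ), δ τ ≤ 0 := by
    filter_upwards [hcont.eventually (lt_mem_nhds hM)] with τ hτ
    set c : Fin N → ℂ := fun i => if i = j then Complex.exp (τ * Complex.I) else 1 with hc
    have hc1 : ∀ i, ‖c i‖ = 1 := fun i => by
      simp only [hc]; split_ifs
      · exact Complex.norm_exp_ofReal_mul_I τ
      · exact norm_one
    have hsum : ∑ i, c i * v i 0 = R + Complex.exp (τ * Complex.I) * z := by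
      have : ∀ i, c i * v i 0
          = v i 0 + if i = j then (Complex.exp (τ * Complex.I) - 1) * z else 0 := fun i => by
        simp only [hc]; split_ifs with h
        · rw [h]; ring
        · ring
      simp only [this, Finset.sum_add_distrib, Finset.sum_ite_eq', Finset.mem_univ, if_true, hR]
      ring
    have hlin := linForm_phase (β := β) (ω := ω) hv.1.1 hc1
    rw [hsum, show ∑ i, v i 0 = R + z by rw [hR]; ring, hv.linForm_eq_lpNormPow] at hlin
    have hle := hv.linForm_le hp (fun i => (hv.1.1 i).const_mul (c i))
      (lpNormPow_phase _ _ hc1) (by rw [hlin]; exact hτ)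
    rw [hlin, hv.linForm_eq_lpNormPow] at hle
    have h1 : 0 ≤ 1 / β * δ τ := by simp only [hδ]; linarith
    have h2 : 1 / β < 0 := by rw [one_div]; exact inv_lt_zero.2 hβ
    by_contra hcon
    exact absurd h1 (not_le.2 (mul_neg_of_neg_of_pos h2 (not_le.1 hcon)))
  have hev' : ∀ᶠ τ in 𝓝 (0 : ℝ), δ (-τ) ≤ 0 := by
    have : Tendsto (fun τ : ℝ => -τ) (𝓝 0) (𝓝 0) := by
      simpa using (continuous_neg.tendsto (0 : ℝ))
    exact this.eventually hev
  -- the sine terms cancel in the sum of the inequalities for `τ` and `-τ`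
  have hboth := (hev.and hev').filter_mono (nhdsWithin_le_nhds (s := Ioi 0))
  obtain ⟨τ, ⟨h1, h2⟩, hτ0, hτ1⟩ := (hboth.and (Ioo_mem_nhdsGT (zero_lt_one' ℝ))).exists
  rw [hδe] at h1 h2
  rw [Real.cos_neg, Real.sin_neg] at h2
  have hcos : Real.cos τ < 1 := by
    have := Real.cos_lt_cos_of_nonneg_of_le_pi (x := 0) le_rfl
      (by linarith [Real.pi_gt_three]) hτ0
    rwa [Real.cos_zero] at this
  by_contra hcon
  push Not at hcon
  nlinarith [mul_pos_of_neg_of_neg (sub_neg.2 hcos) hcon]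

/-- A minimizer consists, up to a global phase, of positive shifted solitons, and it satisfies the
coupling conditions at the vertex. -/
theorem IsNehariMinimizer.exists_eq_soliton {p β ω : ℝ} (hp : 1 < p) (hβ : β < 0) (hω : 0 < ω)
    {v : Fin N → ℝ → ℂ} (hv : IsNehariMinimizer p β ω v) :
    ∃ (e : ℂ) (a : Fin N → ℝ), ‖e‖ = 1 ∧
      (∀ j x, 0 ≤ x → v j x = e * (soliton p ω (a j) x : ℝ)) ∧
      ∀ j, ∑ i, soliton p ω (a i) 0 = β * solitonDeriv p ω (a j) 0 := by
  obtain ⟨G, hG⟩ := hv.exists_isEdgeSolution hp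
  set S := ∑ i, v i 0 with hS
  have hal := fun j => hv.inner_sub_nonneg hp hβ j
  have hal' : ∀ j, ‖v j 0‖ ^ 2 ≤ inner ℝ S (v j 0) := fun j => by
    have := hal j
    rw [inner_sub_left, real_inner_self_eq_norm_sq] at this
    linarith
  have hS0 : S ≠ 0 := by
    intro h0
    obtain ⟨j, x, hx, hne⟩ := hv.1.2.1
    have h1 := hal' j
    rw [h0, inner_zero_left] at h1
    have h2 : v j 0 = 0 := norm_eq_zero.1
      (pow_eq_zero_iff two_ne_zero |>.1 (le_antisymm h1 (sq_nonneg _)))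
    exact hne ((hG j).1.eq_zero_of_eq_zero hp hω le_rfl h2 hx)
  have hβ' : ((1 / β : ℝ) : ℂ) ≠ 0 := by
    exact_mod_cast (one_div_ne_zero hβ.ne)
  have hz : ∀ j, v j 0 ≠ 0 := fun j h0 => by
    have h1 := (hG j).1.norm_deriv_le hp hω le_rfl
    rw [h0, norm_zero, mul_zero, (hG j).2] at h1
    exact mul_ne_zero hβ' hS0 (norm_eq_zero.1 (le_antisymm h1 (norm_nonneg _)))
  choose a ha using fun j => (hG j).1.exists_eq_soliton hp hω (hz j)
  have hSn : 0 < ‖S‖ := norm_pos_iff.2 hS0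
  have hSn' : (‖S‖ : ℂ) ≠ 0 := by exact_mod_cast hSn.ne'
  -- the common derivative at the vertex makes all phases parallel to `S`
  have hphase : ∀ j, v j 0 / ‖v j 0‖ = S / ‖S‖ := fun j => by
    set n : ℝ := ‖v j 0‖
    have hn : 0 < n := norm_pos_iff.2 (hz j)
    have hn' : (n : ℂ) ≠ 0 := by exact_mod_cast hn.ne'
    have h1 : ((1 / β : ℝ) : ℂ) * S = v j 0 / n * (solitonDeriv p ω (a j) 0 : ℝ) := by
      rw [← (hG j).2]; exact (ha j 0 le_rfl).2
    set d := solitonDeriv p ω (a j) 0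
    have hd : (d : ℂ) ≠ 0 := fun h => by
      rw [h, mul_zero] at h1
      exact mul_ne_zero hβ' hS0 h1
    have hβc : (β : ℂ) ≠ 0 := by exact_mod_cast hβ.ne
    have h2 : v j 0 = ((n / (β * d) : ℝ) : ℂ) * S := by
      push_cast at h1 ⊢
      field_simp at h1 ⊢
      linear_combination -h1
    set r := n / (β * d)
    have h3 := hal' j
    rw [h2, ← Complex.real_smul, inner_smul_right, real_inner_self_eq_norm_sq, norm_smul, mul_pow,
      Real.norm_eq_abs, sq_abs] at h3
    have hr0 : r ≠ 0 := fun h => hz j (by rw [h2, h]; simp)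
    have hr : 0 < r := by
      have h4 : r ^ 2 ≤ r := le_of_mul_le_mul_right h3 (by positivity)
      have : 0 < r ^ 2 := by positivity
      linarith
    have hnr : n = r * ‖S‖ := by
      show ‖v j 0‖ = _
      rw [h2, norm_mul, Complex.norm_real, Real.norm_of_nonneg hr.le]
    rw [hnr, h2]
    have : (r : ℂ) ≠ 0 := by exact_mod_cast hr0
    push_cast
    field_simp
  have hv' : ∀ j x, 0 ≤ x → v j x = S / ‖S‖ * (soliton p ω (a j) x : ℝ) := fun j x hx => by
    rw [← hphase j]; exact (ha j x hx).1
  have hsum : ‖S‖ = ∑ i, soliton p ω (a i) 0 := by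
    have h1 : S = S / ‖S‖ * ((∑ i, soliton p ω (a i) 0 : ℝ) : ℂ) := by
      conv_lhs => rw [hS]
      push_cast
      rw [Finset.mul_sum]
      exact Finset.sum_congr rfl fun i _ => hv' i 0 le_rfl
    have h2 : (‖S‖ : ℂ) = ((∑ i, soliton p ω (a i) 0 : ℝ) : ℂ) := by
      rw [div_mul_eq_mul_div, eq_div_iff hSn'] at h1
      exact mul_left_cancel₀ hS0 h1
    exact_mod_cast h2
  refine ⟨S / ‖S‖, a, ?_, hv', fun j => ?_⟩
  · rw [norm_div, Complex.norm_real, norm_norm, div_self hSn.ne']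
  · have h1 := (ha j 0 le_rfl).2
    rw [(hG j).2, hphase j] at h1
    have hβc : (β : ℂ) ≠ 0 := by exact_mod_cast hβ.ne
    have h2 : ((‖S‖ : ℝ) : ℂ) = ((β * solitonDeriv p ω (a j) 0 : ℝ) : ℂ) := by
      push_cast at h1 ⊢
      field_simp at h1
      exact h1
    rw [← hsum]
    exact_mod_cast h2

/-! ### The second variation -/

/-- The necessary second order condition at a local minimum. -/
theorem IsLocalMin.second_deriv_nonneg {F F' : ℝ → ℝ} {c x₀ : ℝ} (hm : IsLocalMin F x₀)
    (h1 : ∀ x, HasDerivAt F (F' x) x) (h2 : HasDerivAt F' c x₀) : 0 ≤ c := by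
  by_contra hc
  push Not at hc
  have hF : deriv F = F' := funext fun x => (h1 x).deriv
  have hmax : IsLocalMax F x₀ := isLocalMax_of_deriv_deriv_neg (by rw [hF, h2.deriv]; exact hc)
    hm.deriv_eq_zero (h1 x₀).continuousAt
  have hconst : F =ᶠ[𝓝 x₀] fun _ => F x₀ := by
    filter_upwards [hm, hmax] with x ha hb using le_antisymm hb ha
  have hF0 : F' =ᶠ[𝓝 x₀] fun _ => 0 := by
    have := hconst.deriv
    rwa [hF, deriv_const'] at this
  have := h2.unique ((hasDerivAt_const x₀ (0 : ℝ)).congr_of_eventuallyEq hF0)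
  exact hc.ne this

theorem soliton_eq_translate (p ω a x : ℝ) : soliton p ω a x = soliton p ω 0 (x + a) := by
  simp [soliton]

theorem solitonDeriv_eq_translate (p ω a x : ℝ) :
    solitonDeriv p ω a x = solitonDeriv p ω 0 (x + a) := by
  rw [solitonDeriv, solitonDeriv, soliton_eq_translate]; simp

theorem integral_Ioi_zero_comp_add (f : ℝ → ℝ) (b : ℝ) :
    ∫ x in Ioi (0 : ℝ), f (x + b) = ∫ x in Ioi b, f x := by
  have h := (measurePreserving_add_right volume b).setIntegral_preimage_emb
    (MeasurableEquiv.addRight b).measurableEmbedding f (Ioi b)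
  rw [← h]
  simp

theorem integrableOn_Ioi_zero_comp_add {f : ℝ → ℝ} {b : ℝ} :
    IntegrableOn (fun x => f (x + b)) (Ioi 0) ↔ IntegrableOn f (Ioi b) := by
  have h := (measurePreserving_add_right volume b).integrableOn_comp_preimage
    (MeasurableEquiv.addRight b).measurableEmbedding (f := f) (s := Ioi b)
  rw [← h]
  simp [Function.comp_def]

theorem hasDerivAt_integral_Ioi {f : ℝ → ℝ} (hf : Continuous f) (hi : ∀ b, IntegrableOn f (Ioi b))
    (x : ℝ) : HasDerivAt (fun b => ∫ t in Ioi b, f t) (-f x) x := by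
  have h : (fun b => ∫ t in Ioi b, f t) =
      fun b => (∫ t in Ioi 0, f t) - ∫ t in (0 : ℝ)..b, f t := by
    funext b
    rw [← intervalIntegral.integral_Ioi_sub_Ioi' (hi 0) (hi b)]; ring
  rw [h]
  exact ((hf.integral_hasStrictDerivAt 0 x).hasDerivAt.const_sub _)

theorem integrableOn_Ioi_of_integrableOn_Ioi {f : ℝ → ℝ} (hf : Continuous f) {a : ℝ}
    (hi : IntegrableOn f (Ioi a)) (b : ℝ) : IntegrableOn f (Ioi b) := by
  refine ((hf.continuousOn.integrableOn_Icc (a := b) (b := a)).union hi).mono_set fun x hx => ?_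
  rcases le_or_gt x a with h | h
  · exact Or.inl ⟨le_of_lt hx, h⟩
  · exact Or.inr h

/-- Two edges carrying the same soliton, with derivative at the vertex determined by the coupling
condition, cannot belong to a minimizer if that soliton is concave at the vertex: shifting one of
them to the left and the other one to the right decreases the action to second order. -/
theorem IsNehariMinimizer.soliton_deriv_deriv_nonneg {p β ω : ℝ} (hp : 1 < p) (hω : 0 < ω)
    (hβ : β < 0) {v : Fin N → ℝ → ℂ} (hv : IsNehariMinimizer p β ω v) {e : ℂ} {a : Fin N → ℝ}
    (he : ‖e‖ = 1) (hva : ∀ j x, 0 ≤ x → v j x = e * (soliton p ω (a j) x : ℝ))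
    (hcoup : ∀ j, ∑ i, soliton p ω (a i) 0 = β * solitonDeriv p ω (a j) 0)
    {i j : Fin N} (hij : i ≠ j) (haij : a i = a j) :
    0 ≤ ω * soliton p ω (a i) 0 - soliton p ω (a i) 0 ^ p := by
  set Y := soliton p ω 0 with hY
  set Y' := solitonDeriv p ω 0 with hY'
  have hYpos : ∀ x, 0 < Y x := soliton_pos hp hω 0
  have hYc : Continuous Y := continuous_soliton hp hω 0
  have dY : ∀ x, HasDerivAt Y (Y' x) x := hasDerivAt_soliton hp hω 0
  have dY' : ∀ x, HasDerivAt Y' (ω * Y x - Y x ^ p) x := hasDerivAt_solitonDeriv hp hω 0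
  have hY'c : Continuous Y' := continuous_iff_continuousAt.2 fun x => (dY' x).continuousAt
  have tr : ∀ b x, soliton p ω b x = Y (x + b) := soliton_eq_translate p ω
  have tr' : ∀ b x, solitonDeriv p ω b x = Y' (x + b) := solitonDeriv_eq_translate p ω
  have hY'le : ∀ x, Y' x ^ 2 ≤ ω * Y x ^ 2 := fun x => by
    have ht : Real.tanh ((p - 1) * √ω / 2 * (x + 0)) ^ 2 ≤ 1 := by
      have := soliton_rpow hp hω 0 x
      have h2 := Real.rpow_pos_of_pos (hYpos x) (p - 1)
      rw [hY, this] at h2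
      have h3 : 0 < (p + 1) * ω / 2 := by positivity
      nlinarith [(pos_iff_pos_of_mul_pos h2).1 h3]
    have h1 : Y' x ^ 2 = √ω ^ 2 * Real.tanh ((p - 1) * √ω / 2 * (x + 0)) ^ 2 * Y x ^ 2 := by
      simp only [hY', solitonDeriv, hY]; ring
    rw [h1, Real.sq_sqrt hω.le]
    have := sq_nonneg (Y x)
    calc _ ≤ ω * 1 * Y x ^ 2 := by gcongr
      _ = _ := by ring
  -- integrability of the soliton is inherited from the minimizer
  have hI2 : ∀ b, IntegrableOn (fun x => Y x ^ 2) (Ioi b) := by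
    refine integrableOn_Ioi_of_integrableOn_Ioi (a := a i) (hYc.pow 2) ?_
    rw [← integrableOn_Ioi_zero_comp_add]
    refine IntegrableOn.congr_fun (integrable_norm_sq (hv.1.1 i).memLp) (fun x hx => ?_)
      measurableSet_Ioi
    rw [hva i x (le_of_lt hx), norm_mul, he, one_mul, Complex.norm_real, Real.norm_eq_abs, sq_abs,
      tr]
  have hI2' : ∀ b, IntegrableOn (fun x => Y' x ^ 2) (Ioi b) := fun b =>
    ((hI2 b).const_mul ω).mono' (hY'c.pow 2).aestronglyMeasurable
      (Eventually.of_forall fun x => by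
        rw [Real.norm_of_nonneg (sq_nonneg _)]; exact hY'le x)
  have hIp : ∀ b, IntegrableOn (fun x => Y x ^ (p + 1)) (Ioi b) := by
    refine integrableOn_Ioi_of_integrableOn_Ioi (a := a i)
      (hYc.rpow_const fun x => Or.inr (by linarith)) ?_
    rw [← integrableOn_Ioi_zero_comp_add]
    refine IntegrableOn.congr_fun ((hv.1.1 i).integrable_rpow (by linarith : 2 ≤ p + 1))
      (fun x hx => ?_) measurableSet_Ioi
    rw [hva i x (le_of_lt hx), norm_mul, he, one_mul, Complex.norm_real,
      Real.norm_of_nonneg (soliton_pos hp hω _ _).le, tr]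
  have hIE : ∀ b, IntegrableOn (fun x => Y' x ^ 2 + ω * Y x ^ 2) (Ioi b) := fun b =>
    (hI2' b).add ((hI2 b).const_mul ω)
  set E : ℝ → ℝ := fun b => ∫ x in Ioi b, (Y' x ^ 2 + ω * Y x ^ 2) with hE
  set Q : ℝ → ℝ := fun b => ∫ x in Ioi b, Y x ^ (p + 1) with hQ
  have dE : ∀ x, HasDerivAt E (-(Y' x ^ 2 + ω * Y x ^ 2)) x :=
    hasDerivAt_integral_Ioi ((hY'c.pow 2).add (continuous_const.mul (hYc.pow 2))) hIE
  have dQ : ∀ x, HasDerivAt Q (-(Y x ^ (p + 1))) x :=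
    hasDerivAt_integral_Ioi (hYc.rpow_const fun x => Or.inr (by linarith)) hIp
  -- functions built from shifted solitons
  set u : (Fin N → ℝ) → Fin N → ℝ → ℂ := fun b l x => e * (soliton p ω (b l) x : ℝ) with hu
  have huL : ∀ b : ℝ, MemLp (fun x => ((soliton p ω b x : ℝ) : ℂ)) 2 (volume.restrict (Ioi 0)) :=
    fun b => by
    refine (memLp_two_iff_integrable_sq_norm (Complex.continuous_ofReal.comp
      (continuous_soliton hp hω b)).aestronglyMeasurable).2 ?_
    have := integrableOn_Ioi_zero_comp_add.2 (hI2 b)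
    refine this.congr (Eventually.of_forall fun x => ?_)
    simp only [Function.comp, Complex.norm_real, Real.norm_eq_abs, sq_abs, tr]
  have huL' : ∀ b : ℝ, MemLp (fun x => ((solitonDeriv p ω b x : ℝ) : ℂ)) 2
      (volume.restrict (Ioi 0)) := fun b => by
    have hc : Continuous (solitonDeriv p ω b) :=
      continuous_iff_continuousAt.2 fun x => (hasDerivAt_solitonDeriv hp hω b x).continuousAt
    refine (memLp_two_iff_integrable_sq_norm
      (Complex.continuous_ofReal.comp hc).aestronglyMeasurable).2 ?_
    have := integrableOn_Ioi_zero_comp_add.2 (hI2' b)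
    refine this.congr (Eventually.of_forall fun x => ?_)
    simp only [Function.comp, Complex.norm_real, Real.norm_eq_abs, sq_abs, tr']
  have huw : ∀ b : ℝ, IsL2WeakDeriv (fun x => ((soliton p ω b x : ℝ) : ℂ))
      (fun x => ((solitonDeriv p ω b x : ℝ) : ℂ)) := fun b =>
    isL2WeakDeriv_of_hasDerivAt (fun x => (hasDerivAt_soliton hp hω b x).ofReal_comp)
      (Complex.continuous_ofReal.comp (continuous_iff_continuousAt.2 fun x =>
        (hasDerivAt_solitonDeriv hp hω b x).continuousAt)) (huL' b)
  have hu1 : ∀ b, MemH1 (u b) := fun b l => MemH1HalfLine.const_mul e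
    ⟨(Complex.continuous_ofReal.comp (continuous_soliton hp hω (b l))).continuousOn, huL (b l), _,
      huw (b l)⟩
  have huP : ∀ b, lpNormPow (p + 1) (u b) = ∑ l, Q (b l) := fun b => by
    refine Finset.sum_congr rfl fun l _ => ?_
    simp only [hQ]
    rw [← integral_Ioi_zero_comp_add (fun x => Y x ^ (p + 1))]
    refine integral_congr_ae (Eventually.of_forall fun x => ?_)
    simp only [hu]
    rw [norm_mul, he, one_mul, Complex.norm_real,
      Real.norm_of_nonneg (soliton_pos hp hω _ _).le, tr]
  have huB : ∀ b, linForm β ω (u b) = ∑ l, E (b l) + 1 / β * (∑ l, Y (b l)) ^ 2 := fun b => by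
    rw [linForm_eq fun l => (huw (b l)).const_mul e]
    have e1 : ∀ l, (∫ x in Ioi (0 : ℝ), ‖e * ((solitonDeriv p ω (b l) x : ℝ) : ℂ)‖ ^ 2)
        + ω * (∫ x in Ioi (0 : ℝ), ‖u b l x‖ ^ 2) = E (b l) := fun l => by
      simp only [hE, hu]
      rw [← integral_Ioi_zero_comp_add (fun x => Y' x ^ 2 + ω * Y x ^ 2),
        integral_add (integrableOn_Ioi_zero_comp_add.2 (hI2' (b l)))
          ((integrableOn_Ioi_zero_comp_add.2 (hI2 (b l))).const_mul ω), integral_const_mul]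
      simp only [norm_mul, he, one_mul, Complex.norm_real, Real.norm_eq_abs, sq_abs, tr, tr']
    have e2 : ‖∑ l, u b l 0‖ ^ 2 = (∑ l, Y (b l)) ^ 2 := by
      have : ∑ l, u b l 0 = e * ((∑ l, Y (b l) : ℝ) : ℂ) := by
        simp only [hu, tr, zero_add]
        rw [← Finset.mul_sum]; push_cast; rfl
      rw [this, norm_mul, he, one_mul, Complex.norm_real, Real.norm_eq_abs, sq_abs]
    rw [e2, ← Finset.sum_congr rfl fun l _ => e1 l, Finset.sum_add_distrib, Finset.mul_sum]
    ring
  have hQa : ∑ l, Q (a l) = lpNormPow (p + 1) v := by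
    rw [← huP]
    refine Finset.sum_congr rfl fun l _ => setIntegral_congr_fun measurableSet_Ioi fun x hx => ?_
    simp only [hu]
    rw [hva l x (le_of_lt hx)]
  have hBa : ∑ l, E (a l) + 1 / β * (∑ l, Y (a l)) ^ 2 = lpNormPow (p + 1) v := by
    rw [← huB, ← hv.linForm_eq_lpNormPow]
    have hg := fun l => isL2WeakDeriv_weakDeriv (hv.1.1 l).exists_weakDeriv
    rw [linForm_eq hg, linForm_eq fun l => (hg l).congr (w := u a l)
      fun x hx => (hva l x (le_of_lt hx)).symm]
    have e1 : ∀ l, ∫ x in Ioi (0 : ℝ), ‖u a l x‖ ^ 2 = ∫ x in Ioi (0 : ℝ), ‖v l x‖ ^ 2 := fun l =>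
      setIntegral_congr_fun measurableSet_Ioi fun x hx => by
        simp only [hu]; rw [hva l x (le_of_lt hx)]
    have e2 : ∀ l, u a l 0 = v l 0 := fun l => (hva l 0 le_rfl).symm
    simp only [e1, e2]
  set M := lpNormPow (p + 1) v
  have hM : 0 < M := hv.lpNormPow_pos hp
  -- shift the soliton on edge `i` to the left and the one on edge `j` to the right; `B` and `P` are
  -- the quadratic part and the `L^(p+1)` part along this variation
  set c : Fin N → ℝ := Pi.single i 1 - Pi.single j 1 with hc
  have hci : c i = 1 := by simp [hc, hij]
  have hcj : c j = -1 := by simp [hc, hij.symm]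
  have hcs : ∀ f : Fin N → ℝ, ∑ l, f l * c l = f i - f j := fun f => by
    simp [hc, mul_sub, Finset.sum_sub_distrib, Pi.single_apply]
  set B : ℝ → ℝ := fun s => ∑ l, E (a l + s * c l) + 1 / β * (∑ l, Y (a l + s * c l)) ^ 2 with hB
  set P : ℝ → ℝ := fun s => ∑ l, Q (a l + s * c l) with hP
  have dl : ∀ (l : Fin N) (s : ℝ), HasDerivAt (fun s => a l + s * c l) (c l) s := fun l s => by
    simpa using ((hasDerivAt_id s).mul_const (c l)).const_add (a l)
  have dsum : ∀ {f f' : ℝ → ℝ}, (∀ x, HasDerivAt f (f' x) x) → ∀ s,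
      HasDerivAt (fun s => ∑ l, f (a l + s * c l)) (∑ l, f' (a l + s * c l) * c l) s :=
    fun hf s => HasDerivAt.fun_sum fun l _ => (hf _).comp s (dl l s)
  set B' : ℝ → ℝ := fun s => ∑ l, -(Y' (a l + s * c l) ^ 2 + ω * Y (a l + s * c l) ^ 2) * c l
    + 1 / β * (2 * (∑ l, Y (a l + s * c l)) * ∑ l, Y' (a l + s * c l) * c l) with hB'
  set P' : ℝ → ℝ := fun s => ∑ l, -(Y (a l + s * c l) ^ (p + 1)) * c l with hP'
  have dB : ∀ s, HasDerivAt B (B' s) s := fun s => by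
    refine ((dsum dE s).fun_add (((dsum dY s).fun_pow 2).const_mul (1 / β))).congr_deriv ?_
    simp only [hB']; push_cast; ring
  have dP : ∀ s, HasDerivAt P (P' s) s := fun s => dsum dQ s
  have dsum' : ∀ {f f' : ℝ → ℝ}, (∀ x, HasDerivAt f (f' x) x) →
      HasDerivAt (fun s => ∑ l, f (a l + s * c l) * c l) (f' (a i) + f' (a j)) 0 :=
    fun {f f'} hf => by
    have h : HasDerivAt (fun s => ∑ l, f (a l + s * c l) * c l)
        (∑ l, f' (a l + 0 * c l) * c l * c l) 0 :=
      HasDerivAt.fun_sum fun l _ => ((hf _).comp 0 (dl l 0)).mul_const (c l)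
    refine h.congr_deriv ?_
    rw [hcs, hci, hcj]
    simp
  have de : ∀ x, HasDerivAt (fun x => -(Y' x ^ 2 + ω * Y x ^ 2))
      (-(2 * Y' x * (ω * Y x - Y x ^ p) + ω * (2 * Y x * Y' x))) x := fun x =>
    ((((dY' x).fun_pow 2).fun_add (((dY x).fun_pow 2).const_mul ω)).fun_neg).congr_deriv (by
      push_cast; ring)
  have dq : ∀ x, HasDerivAt (fun x => -(Y x ^ (p + 1))) (-((p + 1) * Y x ^ p * Y' x)) x := fun x =>
    ((dY x).rpow_const (p := p + 1) (Or.inr (by linarith))).fun_neg.congr_deriv (by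
      rw [add_sub_cancel_right]; ring)
  set y := Y (a i) with hy
  set d := Y' (a i) with hd
  have hσ : ∑ l, Y (a l) = β * d := by
    have := hcoup i
    simp only [tr, tr', zero_add] at this
    exact this
  -- the first derivatives vanish since the solitons on `i` and `j` coincide
  have hB'0 : B' 0 = 0 := by
    simp only [hB', zero_mul, add_zero]
    rw [hcs fun l => -(Y' (a l) ^ 2 + ω * Y (a l) ^ 2), hcs fun l => Y' (a l), haij]
    ring
  have hP'0 : P' 0 = 0 := by
    simp only [hP', zero_mul, add_zero]
    rw [hcs fun l => -(Y (a l) ^ (p + 1)), haij]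
    ring
  have hB0 : B 0 = M := by simp only [hB, zero_mul, add_zero]; exact hBa
  have hP0 : P 0 = M := by simp only [hP, zero_mul, add_zero]; exact hQa
  -- here the coupling condition `hσ` removes the terms in `d * (ω * y - y ^ p)`
  have ddB : HasDerivAt B' (-4 * ω * y * d) 0 := by
    have h1 := (dsum' de).fun_add
      ((((dsum dY 0).const_mul 2).fun_mul (dsum' dY')).const_mul (1 / β))
    refine h1.congr_deriv ?_
    simp only [zero_mul, add_zero]
    rw [hcs fun l => Y' (a l), hσ, ← haij, ← hy, ← hd]
    field_simp [hβ.ne]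
    ring
  have ddP : HasDerivAt P' (-2 * (p + 1) * y ^ p * d) 0 := by
    refine (dsum' dq).congr_deriv ?_
    rw [← haij, ← hy, ← hd]
    ring
  set F : ℝ → ℝ := fun s => B s ^ (p + 1) - M ^ (p - 1) * P s ^ 2 with hF
  have hmin : IsLocalMin F 0 := by
    have hF0 : F 0 = 0 := by
      simp only [hF]
      rw [hB0, hP0, ← Real.rpow_two, ← Real.rpow_add hM, show p - 1 + 2 = p + 1 by ring, sub_self]
    have hcB : Tendsto B (𝓝 0) (𝓝 M) := by
      rw [← hB0]; exact (dB 0).continuousAt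
    filter_upwards [hcB.eventually (lt_mem_nhds hM)] with s hs
    rw [hF0]
    have h1 := hv.le_linForm hp (hu1 fun l => a l + s * c l) (by rw [huB]; exact hs)
    rw [huB, huP] at h1
    exact sub_nonneg.2 h1
  have dF : ∀ s, HasDerivAt F ((p + 1) * (B s ^ p * B' s) - 2 * M ^ (p - 1) * (P s * P' s)) s :=
    fun s => (((dB s).rpow_const (p := p + 1) (Or.inr (by linarith))).fun_sub
      (((dP s).fun_pow 2).const_mul (M ^ (p - 1)))).congr_deriv (by
        rw [add_sub_cancel_right]; push_cast; ring)
  have ddF := ((((dB 0).rpow_const (p := p) (Or.inr hp.le)).fun_mul ddB).const_mul (p + 1)).fun_sub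
    (((dP 0).fun_mul ddP).const_mul (2 * M ^ (p - 1)))
  have key := IsLocalMin.second_deriv_nonneg hmin dF ddF
  rw [hB'0, hP'0, hB0, hP0] at key
  have hMp : M ^ p = M ^ (p - 1) * M := by
    rw [← Real.rpow_add_one hM.ne']; congr 1; ring
  rw [hMp] at key
  have hd0 : d < 0 := by
    have h1 : 0 < ∑ l, Y (a l) := Finset.sum_pos (fun l _ => hYpos _) ⟨i, Finset.mem_univ i⟩
    rw [hσ] at h1
    exact (neg_iff_neg_of_mul_pos h1).1 hβ
  have hMM : 0 < M ^ (p - 1) * M := by positivity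
  have h4 : 0 ≤ (M ^ (p - 1) * M * (4 * (p + 1) * -d)) * (ω * y - y ^ p) := by
    refine key.trans (le_of_eq ?_); ring
  have h5 : 0 < M ^ (p - 1) * M * (4 * (p + 1) * -d) :=
    mul_pos hMM (mul_pos (by linarith) (by linarith))
  rw [tr, zero_add]
  exact nonneg_of_mul_nonneg_right h4 h5

/-! ### The parameters of the asymmetric profile -/

/-- The square of `t₁⁻¹ + (N - 1) tN⁻¹` in terms of `u = log (tN / t₁)`, along the curve
`t₁ ^ (p - 1) - t₁ ^ (p + 1) = tN ^ (p - 1) - tN ^ (p + 1)`. Here `a = (p - 1) / 2` and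
`n = N - 1`. -/
def profileFun (a n u : ℝ) : ℝ :=
  Real.exp u * (Real.sinh ((a + 1) * u) / Real.sinh (a * u)) * (1 + n * Real.exp (-u)) ^ 2

/-- The logarithmic derivative of `profileFun`. -/
def profileFunLogDeriv (a n u : ℝ) : ℝ :=
  1 + ((a + 1) * (Real.cosh ((a + 1) * u) / Real.sinh ((a + 1) * u))
    - a * (Real.cosh (a * u) / Real.sinh (a * u))) - 2 * (n / (Real.exp u + n))

theorem profileFun_pos {a n u : ℝ} (ha : 0 < a) (hn : 0 ≤ n) (hu : 0 < u) :
    0 < profileFun a n u := by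
  have h1 := Real.sinh_pos_iff.2 (mul_pos ha hu)
  have h2 := Real.sinh_pos_iff.2 (mul_pos (by linarith : 0 < a + 1) hu)
  unfold profileFun
  positivity

theorem hasDerivAt_sinh_mul (c u : ℝ) :
    HasDerivAt (fun u : ℝ => Real.sinh (c * u)) (c * Real.cosh (c * u)) u :=
  ((hasDerivAt_id u).const_mul c).sinh.congr_deriv (by simp [mul_comm])

theorem hasDerivAt_cosh_mul (c u : ℝ) :
    HasDerivAt (fun u : ℝ => Real.cosh (c * u)) (c * Real.sinh (c * u)) u :=
  ((hasDerivAt_id u).const_mul c).cosh.congr_deriv (by simp [mul_comm])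

theorem hasDerivAt_profileFun {a n u : ℝ} (ha : 0 < a) (hn : 0 ≤ n) (hu : 0 < u) :
    HasDerivAt (profileFun a n) (profileFun a n u * profileFunLogDeriv a n u) u := by
  have h1 := Real.sinh_pos_iff.2 (mul_pos ha hu)
  have h2 := Real.sinh_pos_iff.2 (mul_pos (by linarith : 0 < a + 1) hu)
  have d1 : HasDerivAt (fun u : ℝ => Real.exp (-u)) (-Real.exp (-u)) u :=
    ((hasDerivAt_id u).fun_neg.exp).congr_deriv (by simp)
  have d := ((Real.hasDerivAt_exp u).fun_mul ((hasDerivAt_sinh_mul (a + 1) u).fun_div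
    (hasDerivAt_sinh_mul a u) h1.ne')).fun_mul (((d1.const_mul n).const_add 1).fun_pow 2)
  refine d.congr_deriv ?_
  have he := Real.exp_pos u
  have : Real.exp u + n ≠ 0 := by positivity
  rw [profileFun, profileFunLogDeriv, Real.exp_neg]
  push_cast
  field_simp
  ring

/-- The function `c ↦ sinh (c u) / c` is larger at `a + 1` than at `a`. -/
theorem sinh_div_le {a u : ℝ} (ha : 0 < a) (hu : 0 ≤ u) :
    (a + 1) * Real.sinh (a * u) ≤ a * Real.sinh ((a + 1) * u) := by
  have hm : MonotoneOn (fun u => a * Real.sinh ((a + 1) * u) - (a + 1) * Real.sinh (a * u))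
      (Ici 0) := by
    have hd : ∀ u, HasDerivAt
        (fun u => a * Real.sinh ((a + 1) * u) - (a + 1) * Real.sinh (a * u))
        (a * (a + 1) * (Real.cosh ((a + 1) * u) - Real.cosh (a * u))) u := fun u =>
      (((hasDerivAt_sinh_mul (a + 1) u).const_mul a).fun_sub
        ((hasDerivAt_sinh_mul a u).const_mul (a + 1))).congr_deriv (by ring)
    refine monotoneOn_of_deriv_nonneg (convex_Ici 0)
      (fun u _ => (hd u).continuousAt.continuousWithinAt)
      (fun u _ => (hd u).differentiableAt.differentiableWithinAt) fun u hu => ?_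
    rw [interior_Ici] at hu
    have hu' : 0 < u := hu
    rw [(hd u).deriv]
    refine mul_nonneg (by positivity) (sub_nonneg.2 (Real.cosh_le_cosh.2 ?_))
    rw [abs_of_pos (by positivity), abs_of_pos (by positivity)]
    nlinarith
  have := hm self_mem_Ici hu hu
  simp only [mul_zero, Real.sinh_zero, sub_zero] at this
  linarith

/-- The function `log ∘ profileFun` is strictly convex on `(0, ∞)` if `n > 0`. -/
theorem profileFunLogDeriv_strictMonoOn {a n : ℝ} (ha : 0 < a) (hn : 0 < n) :
    StrictMonoOn (profileFunLogDeriv a n) (Ioi 0) := by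
  have hm : MonotoneOn (fun u => (a + 1) * (Real.cosh ((a + 1) * u) / Real.sinh ((a + 1) * u))
      - a * (Real.cosh (a * u) / Real.sinh (a * u))) (Ioi 0) := by
    have hd : ∀ u, 0 < u → HasDerivAt
        (fun u => (a + 1) * (Real.cosh ((a + 1) * u) / Real.sinh ((a + 1) * u))
          - a * (Real.cosh (a * u) / Real.sinh (a * u)))
        ((a / Real.sinh (a * u)) ^ 2 - ((a + 1) / Real.sinh ((a + 1) * u)) ^ 2) u := fun u hu => by
      have h1 := Real.sinh_pos_iff.2 (mul_pos ha hu)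
      have h2 := Real.sinh_pos_iff.2 (mul_pos (by linarith : 0 < a + 1) hu)
      refine ((((hasDerivAt_cosh_mul (a + 1) u).fun_div (hasDerivAt_sinh_mul (a + 1) u)
        h2.ne').const_mul (a + 1)).fun_sub (((hasDerivAt_cosh_mul a u).fun_div
        (hasDerivAt_sinh_mul a u) h1.ne').const_mul a)).congr_deriv ?_
      have e1 := Real.cosh_sq ((a + 1) * u)
      have e2 := Real.cosh_sq (a * u)
      field_simp
      linear_combination (-(a + 1) ^ 2 * Real.sinh (a * u) ^ 2) * e1
        + (a ^ 2 * Real.sinh ((a + 1) * u) ^ 2) * e2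
    refine monotoneOn_of_deriv_nonneg (convex_Ioi 0)
      (fun u hu => (hd u hu).continuousAt.continuousWithinAt)
      (fun u hu => (hd u (by rwa [interior_Ioi] at hu)).differentiableAt.differentiableWithinAt)
      fun u hu => ?_
    rw [interior_Ioi] at hu
    have hu' : 0 < u := hu
    have h1 := Real.sinh_pos_iff.2 (mul_pos ha hu')
    have h2 := Real.sinh_pos_iff.2 (mul_pos (by linarith : 0 < a + 1) hu')
    rw [(hd u hu).deriv, sub_nonneg]
    refine pow_le_pow_left₀ (by positivity) ?_ 2
    rw [div_le_div_iff₀ h2 h1]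
    exact sinh_div_le ha hu'.le
  intro x hx y hy hxy
  have h1 := hm hx hy hxy.le
  have h2 : n / (Real.exp y + n) < n / (Real.exp x + n) := by
    have := Real.exp_lt_exp.2 hxy
    have := Real.exp_pos x
    gcongr
  simp only [profileFunLogDeriv] at h1 ⊢
  linarith

theorem tendsto_sinh_mul_div (c : ℝ) :
    Tendsto (fun u : ℝ => Real.sinh (c * u) / u) (𝓝[>] 0) (𝓝 c) := by
  have h := hasDerivAt_iff_tendsto_slope_zero.1 (hasDerivAt_sinh_mul c 0)
  simp only [zero_add, mul_zero, Real.sinh_zero, sub_zero, Real.cosh_zero, mul_one,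
    smul_eq_mul] at h
  refine (h.mono_left (nhdsWithin_mono _ fun x hx => (ne_of_gt hx : x ≠ 0))).congr fun u => ?_
  rw [div_eq_inv_mul]

theorem tendsto_profileFun {a : ℝ} (ha : 0 < a) (n : ℝ) :
    Tendsto (profileFun a n) (𝓝[>] 0) (𝓝 ((a + 1) / a * (1 + n) ^ 2)) := by
  have h1 := (tendsto_sinh_mul_div (a + 1)).div (tendsto_sinh_mul_div a) ha.ne'
  have h2 : Tendsto (fun u : ℝ => Real.exp u) (𝓝[>] 0) (𝓝 1) := by
    have : Tendsto (fun u : ℝ => Real.exp u) (𝓝 0) (𝓝 (Real.exp 0)) :=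
      Real.continuous_exp.tendsto 0
    rw [Real.exp_zero] at this
    exact this.mono_left nhdsWithin_le_nhds
  have h3 : Tendsto (fun u : ℝ => (1 + n * Real.exp (-u)) ^ 2) (𝓝[>] 0) (𝓝 ((1 + n) ^ 2)) := by
    have hc : Continuous fun u : ℝ => (1 + n * Real.exp (-u)) ^ 2 := by fun_prop
    have := hc.tendsto 0
    simp only [neg_zero, Real.exp_zero, mul_one] at this
    exact this.mono_left nhdsWithin_le_nhds
  have h4 := (h2.mul h1).mul h3
  rw [one_mul] at h4
  refine h4.congr' ?_
  filter_upwards [self_mem_nhdsWithin] with u hu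
  have hu' : u ≠ 0 := ne_of_gt hu
  simp only [profileFun, Pi.div_apply]
  rw [div_div_div_cancel_right₀ hu']

theorem exp_mul_sinh_lt {a u : ℝ} (hu : 0 < u) :
    Real.exp u * Real.sinh (a * u) < Real.sinh ((a + 1) * u) := by
  have h1 : Real.sinh ((a + 1) * u)
      = Real.exp u * Real.sinh (a * u) + Real.sinh u * Real.exp (-(a * u)) := by
    rw [show (a + 1) * u = a * u + u by ring, Real.sinh_add, ← Real.cosh_add_sinh u,
      ← Real.cosh_sub_sinh (a * u)]
    ring
  rw [h1]
  have := mul_pos (Real.sinh_pos_iff.2 hu) (Real.exp_pos (-(a * u)))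
  linarith

theorem exists_profileFun_eq {a n c : ℝ} (ha : 0 < a) (hn : 0 < n)
    (hc : (a + 1) / a * (1 + n) ^ 2 < c) : ∃ u, 0 < u ∧ profileFun a n u = c := by
  obtain ⟨u₀, hu₀, h0⟩ := ((tendsto_profileFun ha n).eventually (gt_mem_nhds hc)).and
    self_mem_nhdsWithin |>.exists
  have hu₀' : 0 < u₀ := h0
  set u₁ := max u₀ c
  have hu₁ : 0 < u₁ := hu₀'.trans_le (le_max_left _ _)
  have h1 : c ≤ profileFun a n u₁ := by
    have h1 := Real.sinh_pos_iff.2 (mul_pos ha hu₁)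
    have h3 : Real.exp u₁ ≤ Real.sinh ((a + 1) * u₁) / Real.sinh (a * u₁) := by
      rw [le_div_iff₀ h1]; exact (exp_mul_sinh_lt hu₁).le
    have h4 : 1 ≤ (1 + n * Real.exp (-u₁)) ^ 2 := by
      have : 0 < n * Real.exp (-u₁) := by positivity
      nlinarith
    have h5 : c + 1 ≤ Real.exp u₁ := by
      have := Real.add_one_le_exp u₁
      have := le_max_right u₀ c
      linarith
    have h6 : 1 ≤ Real.exp u₁ := Real.one_le_exp hu₁.le
    calc c ≤ Real.exp u₁ * 1 * 1 := by linarith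
      _ ≤ profileFun a n u₁ := by
        unfold profileFun
        gcongr
        exact h6.trans h3
  have hcont : ContinuousOn (profileFun a n) (Ioi 0) := fun u hu =>
    (hasDerivAt_profileFun ha hn.le hu).continuousAt.continuousWithinAt
  obtain ⟨u, hu, he⟩ := isPreconnected_Ioi.intermediate_value h0 hu₁ hcont ⟨hu₀.le, h1⟩
  exact ⟨u, hu, he⟩

/-- By log-convexity, `profileFun` takes every value above its limit at `0` at most once. -/
theorem profileFun_injOn {a n c u₁ u₂ : ℝ} (ha : 0 < a) (hn : 0 < n)
    (hc : (a + 1) / a * (1 + n) ^ 2 < c) (h1 : 0 < u₁) (h2 : 0 < u₂)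
    (e1 : profileFun a n u₁ = c) (e2 : profileFun a n u₂ = c) : u₁ = u₂ := by
  wlog hlt : u₁ < u₂ generalizing u₁ u₂
  · rcases lt_trichotomy u₁ u₂ with h | h | h
    · exact this h1 h2 e1 e2 h
    · exact h
    · exact (this h2 h1 e2 e1 h).symm
  exfalso
  -- by convexity the function decreases on `(0, ξ]`, so its limit at `0` would be at least `c`
  obtain ⟨ξ, hξ, hz⟩ := exists_hasDerivAt_eq_zero hlt
    (fun u hu =>
      (hasDerivAt_profileFun ha hn.le (h1.trans_le hu.1)).continuousAt.continuousWithinAt)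
    (e1.trans e2.symm) fun u hu => hasDerivAt_profileFun ha hn.le (h1.trans hu.1)
  have hξ0 : 0 < ξ := h1.trans hξ.1
  have hz' : profileFunLogDeriv a n ξ = 0 :=
    (mul_eq_zero.1 hz).resolve_left (profileFun_pos ha hn.le hξ0).ne'
  have hanti : AntitoneOn (profileFun a n) (Ioc 0 ξ) := by
    refine antitoneOn_of_deriv_nonpos (convex_Ioc 0 ξ)
      (fun u hu => (hasDerivAt_profileFun ha hn.le hu.1).continuousAt.continuousWithinAt) ?_ ?_ <;>
      rw [interior_Ioc]
    · exact fun u hu =>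
        (hasDerivAt_profileFun ha hn.le hu.1).differentiableAt.differentiableWithinAt
    · intro u hu
      rw [(hasDerivAt_profileFun ha hn.le hu.1).deriv]
      have := profileFunLogDeriv_strictMonoOn ha hn hu.1 hξ0 hu.2
      exact mul_nonpos_of_nonneg_of_nonpos (profileFun_pos ha hn.le hu.1).le (by linarith)
  have hge : c ≤ (a + 1) / a * (1 + n) ^ 2 := by
    refine ge_of_tendsto (tendsto_profileFun ha n) ?_
    filter_upwards [Ioo_mem_nhdsGT h1] with u hu
    rw [← e1]
    exact hanti ⟨hu.1, hu.2.le.trans hξ.1.le⟩ ⟨h1, hξ.1.le⟩ hu.2.le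
  linarith

theorem exp_two_mul_sub_one (x : ℝ) : Real.exp (2 * x) - 1 = 2 * Real.exp x * Real.sinh x := by
  have h : Real.exp x * Real.exp (-x) = 1 := by rw [← Real.exp_add]; simp
  rw [Real.sinh_eq, two_mul, Real.exp_add]
  linear_combination h

/-- The curve `t₁ ^ (p - 1) - t₁ ^ (p + 1) = tN ^ (p - 1) - tN ^ (p + 1)`, parametrized by
`u = log (tN / t₁)`. -/
theorem slope_eq_iff {p t u : ℝ} (hp : 1 < p) (ht : 0 < t) (hu : 0 < u) :
    t ^ (p - 1) - t ^ (p + 1) = (Real.exp u * t) ^ (p - 1) - (Real.exp u * t) ^ (p + 1) ↔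
      t ^ 2 = Real.exp (-u) * Real.sinh ((p - 1) / 2 * u) / Real.sinh (((p - 1) / 2 + 1) * u) := by
  set a := (p - 1) / 2 with ha
  have ha0 : 0 < a := by rw [ha]; linarith
  have h2 := Real.sinh_pos_iff.2 (mul_pos (by linarith : 0 < a + 1) hu)
  have e1 : t ^ (p + 1) = t ^ (p - 1) * t ^ 2 := by
    rw [← Real.rpow_two, ← Real.rpow_add ht]; congr 1; ring
  have hq : 0 < t ^ (p - 1) := Real.rpow_pos_of_pos ht _
  have e2 : Real.exp u ^ (p - 1) = 1 + 2 * Real.exp (a * u) * Real.sinh (a * u) := by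
    rw [← exp_two_mul_sub_one, ← Real.exp_mul, show 2 * (a * u) = u * (p - 1) by rw [ha]; ring]
    ring
  have e3 : Real.exp u ^ (p + 1) = 1 + 2 * Real.exp ((a + 1) * u) * Real.sinh ((a + 1) * u) := by
    rw [← exp_two_mul_sub_one, ← Real.exp_mul,
      show 2 * ((a + 1) * u) = u * (p + 1) by rw [ha]; ring]
    ring
  have e4 : Real.exp (a * u) = Real.exp ((a + 1) * u) * Real.exp (-u) := by
    rw [← Real.exp_add]; congr 1; ring
  rw [Real.mul_rpow (Real.exp_pos u).le ht.le, Real.mul_rpow (Real.exp_pos u).le ht.le, e1, e2, e3,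
    e4, eq_div_iff h2.ne']
  have hE := Real.exp_pos ((a + 1) * u)
  constructor
  · intro h
    refine mul_left_cancel₀ (mul_pos (mul_pos two_pos hq) hE).ne' ?_
    linear_combination h
  · intro h
    linear_combination (2 * t ^ (p - 1) * Real.exp ((a + 1) * u)) * h

theorem sum_inv_sq_eq_profileFun {p t n u : ℝ} (hp : 1 < p) (ht : 0 < t) (hu : 0 < u)
    (h : t ^ 2 = Real.exp (-u) * Real.sinh ((p - 1) / 2 * u) /
      Real.sinh (((p - 1) / 2 + 1) * u)) :
    (t⁻¹ + n * (Real.exp u * t)⁻¹) ^ 2 = profileFun ((p - 1) / 2) n u := by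
  have h1 := Real.sinh_pos_iff.2 (mul_pos (by linarith : 0 < (p - 1) / 2) hu)
  have h2 := Real.sinh_pos_iff.2 (mul_pos (by linarith : 0 < (p - 1) / 2 + 1) hu)
  have e : (t⁻¹ + n * (Real.exp u * t)⁻¹) ^ 2 = (t ^ 2)⁻¹ * (1 + n * Real.exp (-u)) ^ 2 := by
    rw [Real.exp_neg]; field_simp
  rw [e, h, profileFun, Real.exp_neg]
  field_simp

theorem existsUnique_isProfileParam {N : ℕ} (hN : 2 ≤ N) {p β ω : ℝ} (hp : 1 < p) (hβ : β < 0)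
    (hω : (p + 1) / (p - 1) * ((N : ℝ) ^ 2 / β ^ 2) < ω) :
    ∃! t : ℝ × ℝ, IsProfileParam N 1 p β ω t.1 t.2 := by
  have hω0 : 0 < ω := by
    refine lt_of_le_of_lt ?_ hω
    have : 0 < p - 1 := by linarith
    positivity
  set a := (p - 1) / 2 with ha
  have ha0 : 0 < a := by rw [ha]; linarith
  have hN' : (2 : ℝ) ≤ N := by exact_mod_cast hN
  have hn : 0 < (N : ℝ) - 1 := by linarith
  -- the assumption on `ω` says that `c` exceeds the limit of `profileFun` at `0`
  set c := (|β| * √ω) ^ 2 with hc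
  have hcpos : 0 < |β| * √ω := mul_pos (abs_pos.2 hβ.ne) (Real.sqrt_pos.2 hω0)
  have hlt : (a + 1) / a * (1 + ((N : ℝ) - 1)) ^ 2 < c := by
    have h1 : (a + 1) / a = (p + 1) / (p - 1) := by
      have : p - 1 ≠ 0 := by linarith
      rw [ha]; field_simp; ring
    rw [h1, hc, mul_pow, sq_abs, Real.sq_sqrt hω0.le, add_sub_cancel]
    have hb : 0 < β ^ 2 := by nlinarith
    rw [mul_div_assoc', div_lt_iff₀ hb] at hω
    linarith
  obtain ⟨u, hu, hue⟩ := exists_profileFun_eq ha0 hn hlt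
  have h1 := Real.sinh_pos_iff.2 (mul_pos ha0 hu)
  have h2 := Real.sinh_pos_iff.2 (mul_pos (by linarith : 0 < a + 1) hu)
  have hEu := Real.exp_pos u
  set t := √(Real.exp (-u) * Real.sinh (a * u) / Real.sinh ((a + 1) * u)) with ht
  have ht0 : 0 < t := Real.sqrt_pos.2 (by positivity)
  have ht2 : t ^ 2 = Real.exp (-u) * Real.sinh (a * u) / Real.sinh ((a + 1) * u) :=
    Real.sq_sqrt (by positivity)
  refine ⟨(t, Real.exp u * t), ⟨ht0, ?_, ?_, (slope_eq_iff hp ht0 hu).2 ht2, ?_⟩, ?_⟩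
  · have := Real.one_lt_exp_iff.2 hu
    simp only
    nlinarith
  · refine lt_of_pow_lt_pow_left₀ 2 zero_le_one ?_
    simp only
    rw [mul_pow, ht2, one_pow, Real.exp_neg, ← mul_div_assoc, div_lt_one h2]
    have := exp_mul_sinh_lt (a := a) hu
    calc _ = Real.exp u * Real.sinh (a * u) := by field_simp
      _ < _ := this
  · have := sum_inv_sq_eq_profileFun (n := (N : ℝ) - 1) hp ht0 hu ht2
    rw [hue, hc] at this
    push_cast
    rw [one_mul]
    refine (pow_left_inj₀ ?_ hcpos.le two_ne_zero).1 this
    have : 0 < t⁻¹ := inv_pos.2 ht0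
    positivity
  · rintro ⟨s, sN⟩ hs
    have hs0 : 0 < s := hs.pos
    have hsN : s < sN := hs.lt
    set w := Real.log (sN / s) with hw
    have hw0 : 0 < w := Real.log_pos (by rwa [one_lt_div hs0])
    have hsw : sN = Real.exp w * s := by
      rw [hw, Real.exp_log (div_pos (hs0.trans hsN) hs0)]; field_simp
    have hs2 : s ^ 2 = Real.exp (-w) * Real.sinh (a * w) / Real.sinh ((a + 1) * w) := by
      refine (slope_eq_iff hp hs0 hw0).1 ?_
      rw [← hsw]; exact hs.eq_slope
    have hwe : profileFun a ((N : ℝ) - 1) w = c := by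
      rw [← sum_inv_sq_eq_profileFun hp hs0 hw0 hs2, hc, ← hs.eq_sum, ← hsw]
      push_cast
      simp only [one_mul]
    have huw : w = u := profileFun_injOn ha0 hn hlt hw0 hu hwe hue
    have hst : s = t := by
      refine (pow_left_inj₀ hs0.le ht0.le two_ne_zero).1 ?_
      rw [hs2, ht2, huw]
    rw [hsw, hst, huw]

/-! ### Identification of the minimizers -/

theorem hasDerivAt_slope {p t : ℝ} (ht : 0 < t) :
    HasDerivAt (fun t : ℝ => t ^ (p - 1) - t ^ (p + 1))
      (t ^ (p - 2) * ((p - 1) - (p + 1) * t ^ 2)) t := by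
  refine ((Real.hasDerivAt_rpow_const (p := p - 1) (Or.inl ht.ne')).fun_sub
    (Real.hasDerivAt_rpow_const (p := p + 1) (Or.inl ht.ne'))).congr_deriv ?_
  have e : t ^ (p + 1 - 1) = t ^ (p - 2) * t ^ 2 := by
    rw [← Real.rpow_two, ← Real.rpow_add ht]; congr 1; ring
  rw [e, show p - 1 - 1 = p - 2 by ring]
  ring

theorem slope_strictMonoOn (p : ℝ) (hp : 1 < p) :
    StrictMonoOn (fun t : ℝ => t ^ (p - 1) - t ^ (p + 1)) (Ioc 0 √((p - 1) / (p + 1))) := by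
  refine strictMonoOn_of_deriv_pos (convex_Ioc _ _)
    (fun t ht => (hasDerivAt_slope ht.1).continuousAt.continuousWithinAt) fun t ht => ?_
  rw [interior_Ioc] at ht
  rw [(hasDerivAt_slope ht.1).deriv]
  have h1 := (Real.lt_sqrt ht.1.le).1 ht.2
  rw [lt_div_iff₀ (by linarith)] at h1
  exact mul_pos (Real.rpow_pos_of_pos ht.1 _) (by linarith)

theorem slope_strictAntiOn (p : ℝ) (hp : 1 < p) :
    StrictAntiOn (fun t : ℝ => t ^ (p - 1) - t ^ (p + 1)) (Ici √((p - 1) / (p + 1))) := by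
  have h0 : 0 < √((p - 1) / (p + 1)) := Real.sqrt_pos.2 (div_pos (by linarith) (by linarith))
  refine strictAntiOn_of_deriv_neg (convex_Ici _)
    (fun t ht => (hasDerivAt_slope (h0.trans_le ht)).continuousAt.continuousWithinAt) fun t ht => ?_
  rw [interior_Ici] at ht
  have ht0 : 0 < t := h0.trans ht
  rw [(hasDerivAt_slope ht0).deriv]
  have h1 := (Real.sqrt_lt' ht0).1 ht
  rw [div_lt_iff₀ (by linarith)] at h1
  exact mul_neg_of_pos_of_neg (Real.rpow_pos_of_pos ht0 _) (by linarith)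

/-- The action, the constraint and the function space are invariant under a global phase and
under permutations of the edges. -/
theorem IsNehariMinimizer.of_phase_perm {p β ω : ℝ} {v w : Fin N → ℝ → ℂ}
    (hv : IsNehariMinimizer p β ω v) {c : ℂ} (hc : ‖c‖ = 1) (σ : Equiv.Perm (Fin N))
    (hw : ∀ j x, 0 ≤ x → w j x = c * v (σ j) x) : IsNehariMinimizer p β ω w := by
  have hH : MemH1 w := fun j => ((hv.1.1 (σ j)).const_mul c).congr fun x hx => hw j x hx
  have hlp : ∀ q, lpNormPow q w = lpNormPow q v := fun q => by
    rw [lpNormPow, lpNormPow, ← Equiv.sum_comp σ fun j => ∫ x in Ioi (0 : ℝ), ‖v j x‖ ^ q]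
    refine Finset.sum_congr rfl fun j _ => setIntegral_congr_fun measurableSet_Ioi fun x hx => ?_
    rw [hw j x (le_of_lt hx), norm_mul, hc, one_mul]
  have hq : quadForm β w = quadForm β v := by
    have hg := fun j => isL2WeakDeriv_weakDeriv (hv.1.1 j).exists_weakDeriv
    have hgw : ∀ j, IsL2WeakDeriv (w j) (fun x => c * weakDeriv (v (σ j)) x) := fun j =>
      ((hg (σ j)).const_mul c).congr fun x hx => hw j x (le_of_lt hx)
    have h : linForm β 0 w = linForm β 0 v := by
      rw [linForm_eq hg, linForm_eq hgw]
      have e1 : ∑ j, w j 0 = c * ∑ j, v j 0 := by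
        rw [Finset.mul_sum, ← Equiv.sum_comp σ fun j => c * v j 0]
        exact Finset.sum_congr rfl fun j _ => hw j 0 le_rfl
      have e2 : ∑ j, ∫ x in Ioi (0 : ℝ), ‖c * weakDeriv (v (σ j)) x‖ ^ 2
          = ∑ j, ∫ x in Ioi (0 : ℝ), ‖weakDeriv (v j) x‖ ^ 2 := by
        rw [← Equiv.sum_comp σ fun j => ∫ x in Ioi (0 : ℝ), ‖weakDeriv (v j) x‖ ^ 2]
        simp only [norm_mul, hc, one_mul]
      rw [e1, e2, norm_mul, hc, one_mul, zero_mul, zero_mul]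
    simpa [linForm] using h
  have hS : action p β ω w = action p β ω v := by simp only [action, hq, hlp]
  refine ⟨⟨hH, ?_, ?_⟩, fun u hu => ?_⟩
  · obtain ⟨j, x, hx, hne⟩ := hv.1.2.1
    refine ⟨σ.symm j, x, hx, ?_⟩
    rw [hw _ x hx, Equiv.apply_symm_apply]
    exact mul_ne_zero (norm_ne_zero_iff.1 (by rw [hc]; exact one_ne_zero)) hne
  · rw [← hv.1.2.2]; simp only [nehari, hq, hlp]
  · have := hv.2 hu
    simp only [mem_ofPred_eq] at this ⊢
    rwa [hS]

theorem shift_tanh {p ω : ℝ} (hp : 1 < p) (hω : 0 < ω) (a : ℝ) :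
    shift p ω (Real.tanh ((p - 1) * √ω / 2 * a)) = a := by
  have h1 : p - 1 ≠ 0 := by linarith
  have h2 := (Real.sqrt_pos.2 hω).ne'
  rw [shift, Real.artanh_tanh]
  field_simp

/-- Minimizers have exactly one edge with the small parameter: two of them are excluded by the
second variation, and without any the coupling condition fails because `ω` is large. -/
theorem IsNehariMinimizer.exists_eq_profile (hN : 2 ≤ N) {p β ω : ℝ} (hp : 1 < p) (hβ : β < 0)
    (hω : (p + 1) / (p - 1) * ((N : ℝ) ^ 2 / β ^ 2) < ω) {v : Fin N → ℝ → ℂ}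
    (hv : IsNehariMinimizer p β ω v) {t₁ tN : ℝ} (ht : IsProfileParam N 1 p β ω t₁ tN) :
    ∃ (θ : ℝ) (σ : Equiv.Perm (Fin N)), ∀ j : Fin N, ∀ x : ℝ, 0 ≤ x →
      v j x = Complex.exp (Complex.I * (θ : ℂ)) * ((profile N 1 p ω t₁ tN (σ j) x : ℝ) : ℂ) := by
  have hp1 : 0 < p - 1 := by linarith
  have hω0 : 0 < ω := lt_of_le_of_lt (by positivity) hω
  have hsω := Real.sqrt_pos.2 hω0
  obtain ⟨e, a, he, hva, hcoup⟩ := hv.exists_eq_soliton hp hβ hω0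
  set k := (p - 1) * √ω / 2 with hk
  set t : Fin N → ℝ := fun j => Real.tanh (k * a j)
  set y : Fin N → ℝ := fun j => soliton p ω (a j) 0
  set S := ∑ j, y j with hS
  have hy0 : ∀ j, 0 < y j := fun j => soliton_pos hp hω0 _ _
  have hS0 : 0 < S := Finset.sum_pos (fun j _ => hy0 j) ⟨⟨0, by omega⟩, Finset.mem_univ _⟩
  have hyp : ∀ j, y j ^ (p - 1) = (p + 1) * ω / 2 * (1 - t j ^ 2) := fun j => by
    have := soliton_rpow hp hω0 (a j) 0
    rwa [zero_add] at this
  have hm : 0 < |β| * √ω := mul_pos (abs_pos.2 hβ.ne) hsω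
  have hty : ∀ j, S = |β| * √ω * (t j * y j) := fun j => by
    rw [hS, show ∑ j, y j = β * solitonDeriv p ω (a j) 0 from hcoup j, solitonDeriv, zero_add,
      abs_of_neg hβ]
    ring
  have ht0 : ∀ j, 0 < t j := fun j => by
    have h1 := hty j ▸ hS0
    exact (pos_iff_pos_of_mul_pos ((pos_iff_pos_of_mul_pos h1).1 hm)).2 (hy0 j)
  have ht1 : ∀ j, t j < 1 := fun j => Real.tanh_lt_one _
  have hslope : ∀ i j, t i ^ (p - 1) - t i ^ (p + 1) = t j ^ (p - 1) - t j ^ (p + 1) := by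
    have h1 : ∀ j, t j ^ (p - 1) - t j ^ (p + 1)
        = (S / (|β| * √ω)) ^ (p - 1) / ((p + 1) * ω / 2) := fun j => by
      have h2 : S / (|β| * √ω) = t j * y j := by rw [hty j, mul_div_cancel_left₀ _ hm.ne']
      have h3 : t j ^ (p + 1) = t j ^ (p - 1) * t j ^ 2 := by
        rw [← Real.rpow_two, ← Real.rpow_add (ht0 j)]; congr 1; ring
      rw [h2, Real.mul_rpow (ht0 j).le (hy0 j).le, hyp, h3]
      have : (p + 1) * ω / 2 ≠ 0 := by positivity
      field_simp
    exact fun i j => (h1 i).trans (h1 j).symm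
  have hsum : ∑ j, (t j)⁻¹ = |β| * √ω := by
    have h1 : ∀ j, (t j)⁻¹ = |β| * √ω / S * y j := fun j => by
      have := (ht0 j).ne'
      have h2 := hty j
      field_simp
      linarith
    rw [Finset.sum_congr rfl fun j _ => h1 j, ← Finset.mul_sum, ← hS]
    field_simp
  set τ := √((p - 1) / (p + 1)) with hτ
  have hτ0 : 0 < τ := Real.sqrt_pos.2 (by positivity)
  have hτ2 : τ ^ 2 = (p - 1) / (p + 1) := Real.sq_sqrt (by positivity)
  -- at most one parameter is below the maximum point `τ` of `t ^ (p - 1) - t ^ (p + 1)`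
  have honce : ∀ i j, i ≠ j → t i < τ → τ ≤ t j := by
    intro i j hij hi
    by_contra hj
    push Not at hj
    have htt : t i = t j :=
      (slope_strictMonoOn p hp).injOn ⟨ht0 i, hi.le⟩ ⟨ht0 j, hj.le⟩ (hslope i j)
    have haa : a i = a j := by
      have := Real.tanh_injective htt
      exact mul_left_cancel₀ (by positivity) this
    have h2 := hv.soliton_deriv_deriv_nonneg hp hω0 hβ he hva hcoup hij haa
    have h3 : soliton p ω (a i) 0 ^ p = y i * y i ^ (p - 1) := by
      rw [← Real.rpow_one_add' (hy0 i).le (by linarith)]; congr 1; ring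
    rw [h3, hyp, show soliton p ω (a i) 0 = y i from rfl] at h2
    have h4 : 0 ≤ y i * ω * (1 - (p + 1) / 2 * (1 - t i ^ 2)) := by linarith
    have h5 : 0 ≤ 1 - (p + 1) / 2 * (1 - t i ^ 2) :=
      nonneg_of_mul_nonneg_right h4 (mul_pos (hy0 i) hω0)
    have h6 : t i ^ 2 < τ ^ 2 := by
      have := ht0 i
      gcongr
    rw [hτ2, lt_div_iff₀ (by linarith)] at h6
    linarith
  obtain ⟨j₀, hj₀⟩ : ∃ j, t j < τ := by
    by_contra hcon
    push Not at hcon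
    have h1 : ∑ j, (t j)⁻¹ ≤ ∑ _j : Fin N, τ⁻¹ := Finset.sum_le_sum fun j _ => by
      have := hcon j
      gcongr
    rw [hsum, Finset.sum_const, Finset.card_univ, Fintype.card_fin, nsmul_eq_mul] at h1
    have h2 : (|β| * √ω) ^ 2 ≤ (N * τ⁻¹) ^ 2 := by gcongr
    rw [mul_pow, sq_abs, Real.sq_sqrt hω0.le, mul_pow, inv_pow, hτ2, inv_div] at h2
    have hb : 0 < β ^ 2 := by nlinarith
    rw [mul_div_assoc', div_lt_iff₀ hb] at hω
    linarith
  obtain ⟨j₁, hj₁⟩ : ∃ j, j ≠ j₀ := by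
    have : Nontrivial (Fin N) := Fin.nontrivial_iff_two_le.2 hN
    exact exists_ne j₀
  have hrest : ∀ j, j ≠ j₀ → t j = t j₁ := fun j hj =>
    (slope_strictAntiOn p hp).injOn (honce j₀ j hj.symm hj₀) (honce j₀ j₁ hj₁.symm hj₀)
      (hslope j j₁)
  have hparam : IsProfileParam N 1 p β ω (t j₀) (t j₁) := by
    refine ⟨ht0 _, hj₀.trans_le (honce j₀ j₁ hj₁.symm hj₀), ht1 _, hslope _ _, ?_⟩
    rw [← hsum, ← Finset.add_sum_erase _ _ (Finset.mem_univ j₀)]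
    have h1 : ∑ j ∈ Finset.univ.erase j₀, (t j)⁻¹ = ∑ _j ∈ Finset.univ.erase j₀, (t j₁)⁻¹ :=
      Finset.sum_congr rfl fun j hj => by rw [hrest j (Finset.ne_of_mem_erase hj)]
    rw [h1, Finset.sum_const, Finset.card_erase_of_mem (Finset.mem_univ _), Finset.card_univ,
      Fintype.card_fin, nsmul_eq_mul, Nat.cast_sub (by omega)]
    push_cast
    ring
  have huniq := (existsUnique_isProfileParam hN hp hβ hω).unique
    (y₁ := (t j₀, t j₁)) (y₂ := (t₁, tN)) hparam ht
  obtain ⟨rfl, rfl⟩ := Prod.mk.inj huniq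
  refine ⟨e.arg, Equiv.swap j₀ ⟨0, by omega⟩, fun j x hx => ?_⟩
  have hexp : Complex.exp (Complex.I * (e.arg : ℂ)) = e := by
    have := Complex.norm_mul_exp_arg_mul_I e
    rwa [he, Complex.ofReal_one, one_mul, mul_comm] at this
  have hsh : ∀ i, shift p ω (t i) = a i := fun i => shift_tanh hp hω0 (a i)
  rw [hva j x hx, hexp]
  congr 2
  rw [profile]
  by_cases hj : j = j₀
  · rw [hj, Equiv.swap_apply_left, if_pos (by simp), hsh]
  · rw [if_neg, ← hrest j hj, hsh]
    intro hlt
    have h0 : Equiv.swap j₀ (⟨0, by omega⟩ : Fin N) j = ⟨0, by omega⟩ :=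
      Fin.ext (by simpa using hlt)
    rw [Equiv.swap_apply_eq_iff, Equiv.swap_apply_right] at h0
    exact hj h0

end StarGraph

end

theorem theorem4p3 (N : ℕ) (hN : 2 ≤ N) (p β ω : ℝ) (hp : 1 < p) (hβ : β < 0)
    (hω : (p + 1) / (p - 1) * ((N : ℝ) ^ 2 / β ^ 2) < ω) :
    (∃! t : ℝ × ℝ, StarGraph.IsProfileParam N 1 p β ω t.1 t.2) ∧
    ∀ t₁ tN : ℝ, StarGraph.IsProfileParam N 1 p β ω t₁ tN →
      (∃ v : Fin N → ℝ → ℂ, StarGraph.IsNehariMinimizer p β ω v) →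
      ∀ v : Fin N → ℝ → ℂ, StarGraph.IsNehariMinimizer p β ω v ↔
        ∃ (θ : ℝ) (σ : Equiv.Perm (Fin N)), ∀ j : Fin N, ∀ x : ℝ, 0 ≤ x →
          v j x = Complex.exp (Complex.I * (θ : ℂ)) *
            ((StarGraph.profile N 1 p ω t₁ tN (σ j) x : ℝ) : ℂ) := by
  refine ⟨StarGraph.existsUnique_isProfileParam hN hp hβ hω, fun t₁ tN ht ⟨v₀, hv₀⟩ v =>
    ⟨fun hv => hv.exists_eq_profile hN hp hβ hω ht, ?_⟩⟩
  rintro ⟨θ, σ, hv⟩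
  -- the given minimizer has the same form, so that `v` arises from it by a phase and a permutation
  obtain ⟨θ₀, σ₀, h₀⟩ := hv₀.exists_eq_profile hN hp hβ hω ht
  refine hv₀.of_phase_perm (c := Complex.exp (((θ - θ₀ : ℝ) : ℂ) * Complex.I))
    (Complex.norm_exp_ofReal_mul_I _) (σ.trans σ₀.symm) fun j x hx => ?_
  rw [hv j x hx, h₀ _ x hx, Equiv.trans_apply, Equiv.apply_symm_apply, ← mul_assoc,
    ← Complex.exp_add]
  congr 2
  push_cast
  ring
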